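/- Let $H>0$. A double-sided Lévy process $\bar Y=(\bar Y_s)_{s\in\mathbb R}$ is a real process with stationary and independent increments, a.s. càdlàg paths, and $\bar Y_0=0$ a.s. An additive process $X=(X_t)_{t\ge 0}$ is a real process with independent increments, $X_0=0$ a.s., continuous in probability, with a.s. càdlàg paths. $X$ is $H$-self-similar if for every $c>0$ the processes $(X_{ct})_{t\ge0}$ and $(c^HX_t)_{t\ge0}$ have the same finite-dimensional distributions. The law of a random variable $S$ is selfdecomposable if for every $b>1$ there is a random variable $R_b$, independent of $S$, such that $S\overset{d}{=}b^{-1}S+R_b$ (the probability space being enlarged if necessary). An $H$-self-similar Sato process is an additive $H$-self-similar process $X$ such that the law of $X_1$ is selfdecomposable. For a càdlàg path $g$, the integral $\int_a^b e^{-s}\,dg(s)$ is taken over $[a,b]$ and evaluated by parts, i.e. it equals $e^{-b}g(b)-e^{-a}g(a-)+\int_a^b e^{-s}g(s)\,ds$, and $\int_a^\infty e^{-s}\,dg(s)$ is its limit as $b\to\infty$. (i) Let $\bar Y$ be a double-sided Lévy process with $\mathbb E\ln^+|\bar Y_1|<\infty$. Then, almost surely, $\int_a^\infty e^{-s}\,d\bar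 Y_s$ converges for all $a\in\mathbb R$, and the process $$X_t=\int_{\ln(t^{-H})}^\infty e^{-s}\,d\bar Y_s\quad(t>0),\qquad X_0=0,$$ is an $H$-self-similar Sato process. (ii) Conversely, let $X$ be an $H$-self-similar Sato process. Then there is, on the same probability space, a double-sided Lévy process $\bar Y$ with $\mathbb E\ln^+|\bar Y_1|<\infty$ such that, almost surely, $\int_a^\infty e^{-s}\,d\bar Y_s$ converges for all $a\in\mathbb R$, and for every $t\ge 0$, almost surely, $X_t$ equals the value at time $t$ of the process defined from $\bar Y$ in (i). -/

import Mathlib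

open MeasureTheory ProbabilityTheory Filter Topology
open scoped NNReal

/-- A function is càdlàg: right-continuous with finite left limits at every point. (On `ℝ≥0` the
left-limit condition is void at `0`.) -/
def IsCadlag {T : Type*} [TopologicalSpace T] [Preorder T] (f : T → ℝ) : Prop :=
  ∀ t, ContinuousWithinAt f (Set.Ici t) t ∧ ∃ l, Tendsto f (𝓝[<] t) (𝓝 l)

/-- `Y = (Y_s)_{s ∈ ℝ}` is a double-sided real Lévy process under `P`: stationary and independent
increments, almost surely càdlàg paths, and `Y_0 = 0` a.s. -/
structure IsDoubleSidedLevy {Ω : Type*} [MeasurableSpace Ω] (Y : ℝ → Ω → ℝ) (P : Measure Ω) :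
    Prop where
  aemeasurable : ∀ s, AEMeasurable (Y s) P
  zero : ∀ᵐ ω ∂P, Y 0 ω = 0
  indep : HasIndepIncrements Y P
  stationary : ∀ s t h : ℝ, s ≤ t →
    IdentDistrib (fun ω ↦ Y (t + h) ω - Y (s + h) ω) (fun ω ↦ Y t ω - Y s ω) P P
  cadlag : ∀ᵐ ω ∂P, IsCadlag (fun s ↦ Y s ω)

/-- `X = (X_t)_{t ≥ 0}` is a real additive process under `P`: independent increments, `X_0 = 0`
a.s., continuity in probability, and almost surely càdlàg paths. -/
structure IsAdditiveProcess {Ω : Type*} [MeasurableSpace Ω] (X : ℝ≥0 → Ω → ℝ) (P : Measure Ω) :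
    Prop where
  aemeasurable : ∀ t, AEMeasurable (X t) P
  zero : ∀ᵐ ω ∂P, X 0 ω = 0
  indep : HasIndepIncrements X P
  stochContinuous : ∀ t, TendstoInMeasure P X (𝓝 t) (X t)
  cadlag : ∀ᵐ ω ∂P, IsCadlag (fun t ↦ X t ω)

/-- `X` is `H`-self-similar: for every `c > 0` the processes `(X_{ct})_{t ≥ 0}` and
`(c^H X_t)_{t ≥ 0}` have the same finite-dimensional distributions. -/
def IsSelfSimilar {Ω : Type*} [MeasurableSpace Ω] (H : ℝ) (X : ℝ≥0 → Ω → ℝ) (P : Measure Ω) :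
    Prop :=
  ∀ c : ℝ≥0, 0 < c → ∀ I : Finset ℝ≥0,
    IdentDistrib (fun ω (t : I) ↦ X (c * t) ω) (fun ω (t : I) ↦ (c : ℝ) ^ H * X t ω) P P

/-- A law `μ` on `ℝ` is selfdecomposable: for every `b > 1` it is the law of `b⁻¹ S + R` where
`S` has law `μ` and `R` is some random variable independent of `S` (with law `ρ`). -/
def IsSelfdecomposable (μ : Measure ℝ) : Prop :=
  ∀ b : ℝ, 1 < b → ∃ ρ : Measure ℝ, IsProbabilityMeasure ρ ∧ μ = (μ.map (fun x ↦ b⁻¹ * x)) ∗ ρ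

/-- `X` is a Sato process with self-similarity exponent `H`: an additive `H`-self-similar process
whose law at time `1` is selfdecomposable. -/
structure IsSatoProcess {Ω : Type*} [MeasurableSpace Ω] (H : ℝ) (X : ℝ≥0 → Ω → ℝ)
    (P : Measure Ω) : Prop where
  additive : IsAdditiveProcess X P
  selfSimilar : IsSelfSimilar H X P
  selfdecomposable : IsSelfdecomposable (P.map (X 1))

/-- The pathwise integral `∫_{[a, b]} f(s) dg(s)` of a `C¹` function `f` against a càdlàg
path `g`, evaluated by parts. The interval is closed: a jump of `g` at `a` is counted. -/
noncomputable def pathIntegral (f g : ℝ → ℝ) (a b : ℝ) : ℝ :=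
  f b * g b - f a * Function.leftLim g a - ∫ s in a..b, deriv f s * g s

/-- The improper integral `∫_{[a, ∞)} e^{-s} dg(s)` converges, with value `x`. -/
def HasExpIntegral (g : ℝ → ℝ) (a x : ℝ) : Prop :=
  Tendsto (fun b ↦ pathIntegral (fun s ↦ Real.exp (-s)) g a b) atTop (𝓝 x)

open Classical in
/-- The value of `∫_{[a, ∞)} e^{-s} dg(s)` (and `0` if the integral diverges). -/
noncomputable def expIntegral (g : ℝ → ℝ) (a : ℝ) : ℝ :=
  if h : ∃ x, HasExpIntegral g a x then h.choose else 0

/-- The process `X_t = ∫_{ln(t^{-H})}^∞ e^{-s} dY_s`, `t ≥ 0`. At `t = 0` the lower limit is `+∞`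
and the integral is `0`. -/
noncomputable def satoIntegral {Ω : Type*} (H : ℝ) (Y : ℝ → Ω → ℝ) (t : ℝ≥0) (ω : Ω) : ℝ :=
  if t = 0 then 0 else expIntegral (fun s ↦ Y s ω) (Real.log ((t : ℝ) ^ (-H)))

/-! ### Càdlàg paths and pathwise Stieltjes integrals -/

/-! The substitution `s = -H ln t` turns self-similarity into stationarity. With `A_s =
X_{e^{-s/H}}`, formally `dA_s = -e^{-s} dY_s`, and both directions consist in solving this relation
path by path. As the weights `e^{±s}` are smooth, every integral is defined by parts and is a limit
of finite sums of increments (`tendsto_stSum`). Measurability with respect to the increments on an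
interval, and equality of laws, therefore pass from the integrator to the integral
(`aestronglyMeasurable_stInt`, `identDistrib_stInt`); independence then follows from
`HasIndepIncrements.indep_incrSigma`.

From `Y` to `X`: the logarithmic moment makes `P(|Y_{n+1} - Y_n| > e^{n/2})` summable. Ottaviani's
inequality and Borel–Cantelli upgrade this to `|Y_s| ≤ C e^{s/2}` for `s ≥ 0`
(`ae_exists_exp_bound`), so the integrals converge and have the explicit value `expTail`, from which
path regularity is read off. Shifting `Y` by `ln (c^{-H})` multiplies the integral by `c^H`, which
is self-similarity. Selfdecomposability follows from `X_1 = X_c + (X_1 - X_c)` with `c^H = b⁻¹`.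

From `X` to `Y`: put `Y_s = -∫_{(0,s]} e^r dA_r`, with `A` made right-continuous. Scaling gives
stationary increments, and integration by parts yields `∫_{[a,b]} e^{-s} dY_s = A_{a-} - A_b`, where
`A_{a-} = X_{e^{-a/H}}` and `A_b → X_0 = 0`. Since `A` is bounded on `[0,∞)`, `|Y_s| ≤ 2C e^s`; the
converse Borel–Cantelli lemma applied to the independent unit increments then forces the logarithmic
moment (`integrable_posLog`). -/

theorem IsCadlag.tendsto_leftLim {g : ℝ → ℝ} (hg : IsCadlag g) (a : ℝ) :
    Tendsto g (𝓝[<] a) (𝓝 (g.leftLim a)) :=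
  tendsto_leftLim_of_tendsto (hg a).2

theorem IsCadlag.exists_bound {g : ℝ → ℝ} (hg : IsCadlag g) (a b : ℝ) :
    ∃ C, ∀ r ∈ Set.Icc a b, |g r| ≤ C := by
  refine (isCompact_Icc (a := a) (b := b)).induction_on
    (p := fun s ↦ ∃ C, ∀ r ∈ s, |g r| ≤ C) ⟨0, by simp⟩ ?_ ?_ ?_
  · rintro s t hst ⟨C, hC⟩
    exact ⟨C, fun r hr ↦ hC r (hst hr)⟩
  · rintro s t ⟨C, hC⟩ ⟨D, hD⟩
    refine ⟨max C D, fun r hr ↦ ?_⟩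
    rcases hr with hr | hr
    · exact (hC r hr).trans (le_max_left _ _)
    · exact (hD r hr).trans (le_max_right _ _)
  · intro x _
    obtain ⟨hr, l, hl⟩ := hg x
    have h1 : ∀ᶠ r in 𝓝[≥] x, |g r| ≤ |g x| + 1 :=
      (hr.tendsto.abs.eventually_le_const (lt_add_one _))
    have h2 : ∀ᶠ r in 𝓝[<] x, |g r| ≤ |l| + 1 := hl.abs.eventually_le_const (lt_add_one _)
    have h3 : ∀ᶠ r in 𝓝 x, |g r| ≤ max (|g x| + 1) (|l| + 1) := by
      rw [← nhdsLT_sup_nhdsGE, eventually_sup]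
      exact ⟨h2.mono fun r hr ↦ hr.trans (le_max_right _ _),
        h1.mono fun r hr ↦ hr.trans (le_max_left _ _)⟩
    exact ⟨_, mem_nhdsWithin_of_mem_nhds h3, _, fun r hr ↦ hr⟩

theorem IsCadlag.neg {g : ℝ → ℝ} (hg : IsCadlag g) : IsCadlag fun s ↦ - g s :=
  fun a ↦ ⟨(hg a).1.neg, let ⟨l, hl⟩ := (hg a).2; ⟨-l, hl.neg⟩⟩

theorem IsCadlag.sub_const {g : ℝ → ℝ} (hg : IsCadlag g) (c : ℝ) : IsCadlag fun s ↦ g s - c :=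
  fun a ↦ ⟨(hg a).1.sub continuousWithinAt_const, let ⟨l, hl⟩ := (hg a).2; ⟨l - c, hl.sub_const c⟩⟩

theorem IsCadlag.const_mul {g : ℝ → ℝ} (hg : IsCadlag g) (c : ℝ) : IsCadlag fun s ↦ c * g s :=
  fun a ↦ ⟨continuousWithinAt_const.mul (hg a).1, let ⟨l, hl⟩ := (hg a).2; ⟨c * l, hl.const_mul c⟩⟩

theorem IsCadlag.comp_add_const {g : ℝ → ℝ} (hg : IsCadlag g) (h : ℝ) :
    IsCadlag fun s ↦ g (s + h) := by
  refine fun r ↦ ⟨(hg (r + h)).1.comp (f := fun r ↦ r + h) (by fun_prop)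
    fun y hy ↦ add_le_add_left hy h, ?_⟩
  obtain ⟨l, hl⟩ := (hg (r + h)).2
  refine ⟨l, hl.comp (f := fun r ↦ r + h) (tendsto_nhdsWithin_iff.2 ⟨?_, ?_⟩)⟩
  · exact ((continuous_id.add continuous_const).tendsto r).mono_left nhdsWithin_le_nhds
  · filter_upwards [self_mem_nhdsWithin] with y hy using add_lt_add_left hy h

/-- The smallest point of the grid `s + δ ℤ` that is at least `r`. -/
noncomputable def gridCeil (s δ r : ℝ) : ℝ := s + ⌈(r - s) / δ⌉ * δ

theorem le_gridCeil (s r : ℝ) {δ : ℝ} (hδ : 0 < δ) : r ≤ gridCeil s δ r := by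
  have := mul_le_mul_of_nonneg_right (Int.le_ceil ((r - s) / δ)) hδ.le
  rw [div_mul_cancel₀ _ hδ.ne'] at this
  unfold gridCeil; linarith

theorem gridCeil_lt (s r : ℝ) {δ : ℝ} (hδ : 0 < δ) : gridCeil s δ r < r + δ := by
  have := mul_lt_mul_of_pos_right (Int.ceil_lt_add_one ((r - s) / δ)) hδ
  rw [add_mul, div_mul_cancel₀ _ hδ.ne'] at this
  unfold gridCeil; linarith

theorem gridCeil_eq {s r δ : ℝ} (hδ : 0 < δ) (k : ℕ) (h1 : s + k * δ < r)
    (h2 : r ≤ s + (k + 1 : ℕ) * δ) : gridCeil s δ r = s + (k + 1 : ℕ) * δ := by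
  have : ⌈(r - s) / δ⌉ = (k + 1 : ℕ) := by
    rw [Int.ceil_eq_iff]
    push_cast at *
    constructor
    · rw [lt_div_iff₀ hδ]; linarith
    · rw [div_le_iff₀ hδ]; linarith
  unfold gridCeil
  rw [this]; push_cast; ring

/-- The function factors through an integer-valued ceiling, so nothing is required of `g`. Grid
points approach from the right, so right-continuity of `g` suffices for convergence. -/
theorem measurable_comp_gridCeil (g : ℝ → ℝ) (s δ : ℝ) :
    Measurable fun r ↦ g (gridCeil s δ r) := by
  have h1 : Measurable fun n : ℤ ↦ g (s + n * δ) := measurable_of_countable _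
  exact h1.comp (Int.measurable_ceil.comp ((measurable_id.sub_const s).div_const δ))

theorem tendsto_gridCeil {δ : ℕ → ℝ} (hδ : ∀ n, 0 < δ n) (h0 : Tendsto δ atTop (𝓝 0)) (s r : ℝ) :
    Tendsto (fun n ↦ gridCeil s (δ n) r) atTop (𝓝[≥] r) := by
  refine tendsto_nhdsWithin_iff.2 ⟨?_, .of_forall fun n ↦ le_gridCeil s r (hδ n)⟩
  refine tendsto_of_tendsto_of_tendsto_of_le_of_le tendsto_const_nhds
    (h := fun n ↦ r + δ n) ?_ (fun n ↦ le_gridCeil s r (hδ n))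
    (fun n ↦ (gridCeil_lt s r (hδ n)).le)
  simpa using h0.const_add r

theorem IsCadlag.measurable {g : ℝ → ℝ} (hg : IsCadlag g) : Measurable g := by
  refine measurable_of_tendsto_metrizable (fun n : ℕ ↦ measurable_comp_gridCeil g 0 (1 / (n + 1)))
    (tendsto_pi_nhds.2 fun r ↦ ?_)
  exact (hg r).1.tendsto.comp (tendsto_gridCeil (fun n ↦ by positivity)
    tendsto_one_div_add_atTop_nhds_zero_nat 0 r)

theorem IsCadlag.intervalIntegrable {g : ℝ → ℝ} (hg : IsCadlag g) {f : ℝ → ℝ}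
    (hf : Continuous f) (a b : ℝ) : IntervalIntegrable (fun r ↦ f r * g r) volume a b := by
  obtain ⟨C, hC⟩ := hg.exists_bound (min a b) (max a b)
  have hfi : IntervalIntegrable f volume a b := hf.intervalIntegrable a b
  have : IntervalIntegrable (fun r ↦ C * f r) volume a b := hfi.const_mul C
  refine this.mono_fun (hf.measurable.mul hg.measurable).aestronglyMeasurable ?_
  refine (ae_restrict_iff' measurableSet_uIoc).2 (.of_forall fun r hr ↦ ?_)
  have h := hC r (Set.Ioc_subset_Icc_self hr)
  have hC0 : 0 ≤ C := (abs_nonneg _).trans h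
  simp only [norm_mul, Real.norm_eq_abs, abs_of_nonneg hC0]
  rw [mul_comm]
  gcongr

/-- The Stieltjes integral `∫_{(s, t]} w dg`, evaluated by parts. -/
noncomputable def stInt (w g : ℝ → ℝ) (s t : ℝ) : ℝ :=
  w t * g t - w s * g s - ∫ r in s..t, deriv w r * g r

theorem pathIntegral_eq_stInt (w g : ℝ → ℝ) (a b : ℝ) :
    pathIntegral w g a b = stInt w g a b + w a * (g a - g.leftLim a) := by
  unfold pathIntegral stInt; ring

theorem stInt_add {w g : ℝ → ℝ} (hw : ContDiff ℝ 1 w) (hg : IsCadlag g) (s t u : ℝ) :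
    stInt w g s t + stInt w g t u = stInt w g s u := by
  have hc := hw.continuous_deriv le_rfl
  have := intervalIntegral.integral_add_adjacent_intervals (hg.intervalIntegrable hc s t)
    (hg.intervalIntegrable hc t u)
  unfold stInt
  linarith

theorem integral_deriv_eq_sub_of_contDiff {w : ℝ → ℝ} (hw : ContDiff ℝ 1 w) (s t : ℝ) :
    ∫ r in s..t, deriv w r = w t - w s :=
  intervalIntegral.integral_deriv_eq_sub (fun x _ ↦ (hw.differentiable one_ne_zero) x)
    ((hw.continuous_deriv le_rfl).intervalIntegrable s t)

/-- The integral sees only increments of the integrator; this allows normalizing `g` to vanish at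
the left endpoint. -/
theorem stInt_sub_const {w g : ℝ → ℝ} (hw : ContDiff ℝ 1 w) (hg : IsCadlag g) (c s t : ℝ) :
    stInt w (fun r ↦ g r - c) s t = stInt w g s t := by
  have hc := hw.continuous_deriv le_rfl
  unfold stInt
  simp only [mul_sub]
  rw [intervalIntegral.integral_sub (hg.intervalIntegrable hc s t)
    ((hc.intervalIntegrable s t).mul_const c), intervalIntegral.integral_mul_const,
    integral_deriv_eq_sub_of_contDiff hw]
  ring

theorem stInt_const_mul (w g : ℝ → ℝ) (c s t : ℝ) :
    stInt w (fun r ↦ c * g r) s t = c * stInt w g s t := by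
  unfold stInt
  have : ∀ r, deriv w r * (c * g r) = c * (deriv w r * g r) := fun r ↦ by ring
  simp only [this, intervalIntegral.integral_const_mul]
  ring

/-- The `j`-th point of the partition of `[s, t]` into `N + 1` equal parts. -/
noncomputable def gridPt (s t : ℝ) (N j : ℕ) : ℝ := s + j * ((t - s) / (N + 1))

theorem gridPt_mem {s t : ℝ} (h : s ≤ t) {N j : ℕ} (hj : j ≤ N + 1) :
    gridPt s t N j ∈ Set.Icc s t := by
  have h1 : (0 : ℝ) ≤ (t - s) / (N + 1) := div_nonneg (by linarith) (by positivity)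
  have h2 : (j : ℝ) ≤ N + 1 := by exact_mod_cast hj
  have h3 : (j : ℝ) * ((t - s) / (N + 1)) ≤ (N + 1) * ((t - s) / (N + 1)) := by gcongr
  rw [mul_div_cancel₀ _ (by positivity : (N + 1 : ℝ) ≠ 0)] at h3
  unfold gridPt
  constructor
  · have : 0 ≤ (j : ℝ) * ((t - s) / (N + 1)) := by positivity
    linarith
  · linarith

/-- A discretization of `∫_{(s, t]} w dg` that depends on increments of `g` over `[s, t]` only. -/
noncomputable def stSum (w g : ℝ → ℝ) (s t : ℝ) (N : ℕ) : ℝ :=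
  w t * (g t - g s) - ∑ j ∈ Finset.range (N + 1),
    (w (gridPt s t N (j + 1)) - w (gridPt s t N j)) * (g (gridPt s t N (j + 1)) - g s)

/-- Normalize to `G = g - g s` and replace `G` by its value at the next grid point. Dominated
convergence applies by right-continuity, and on each cell the integrand is `deriv w` times a
constant, so the integral is exactly the finite sum. -/
theorem tendsto_stSum {w g : ℝ → ℝ} (hw : ContDiff ℝ 1 w) (hg : IsCadlag g) {s t : ℝ}
    (hst : s ≤ t) : Tendsto (stSum w g s t) atTop (𝓝 (stInt w g s t)) := by
  rcases hst.eq_or_lt with rfl | hlt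
  · refine tendsto_const_nhds.congr fun N ↦ ?_
    simp [stSum, stInt, gridPt]
  have hc := hw.continuous_deriv le_rfl
  set G : ℝ → ℝ := fun r ↦ g r - g s with hG
  have hGc : IsCadlag G := hg.sub_const (g s)
  set δ : ℕ → ℝ := fun N ↦ (t - s) / (N + 1) with hδdef
  have hδ : ∀ N, 0 < δ N := fun N ↦ div_pos (by linarith) (by positivity)
  have hδ0 : Tendsto δ atTop (𝓝 0) := by
    have := tendsto_one_div_add_atTop_nhds_zero_nat (𝕜 := ℝ).const_mul (t - s)
    simpa [hδdef, div_eq_mul_inv] using this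
  rw [← stInt_sub_const hw hg (g s)]
  change Tendsto _ _ (𝓝 (stInt w G s t))
  have hlim : Tendsto (fun N ↦ ∫ r in s..t, deriv w r * G (gridCeil s (δ N) r)) atTop
      (𝓝 (∫ r in s..t, deriv w r * G r)) := by
    -- The next grid point may overshoot `t`, but by less than the mesh, which is at most `t - s`.
    obtain ⟨C, hC⟩ := hGc.exists_bound s (t + (t - s))
    have hC0 : 0 ≤ C := (abs_nonneg _).trans (hC s ⟨le_rfl, by linarith⟩)
    refine intervalIntegral.tendsto_integral_filter_of_dominated_convergence
      (fun r ↦ |deriv w r| * C) (.of_forall fun N ↦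
        (hc.measurable.mul (measurable_comp_gridCeil G s (δ N))).aestronglyMeasurable) ?_
      ((hc.abs.mul continuous_const).intervalIntegrable s t) ?_
    · refine .of_forall fun N ↦ .of_forall fun r hr ↦ ?_
      rw [Set.uIoc_of_le hst] at hr
      have h1 := le_gridCeil s r (hδ N)
      have h2 := gridCeil_lt s r (hδ N)
      have h3 : δ N ≤ t - s := div_le_self (by linarith) (by
        have : (0 : ℝ) ≤ N := by positivity
        linarith)
      rw [norm_mul, Real.norm_eq_abs, Real.norm_eq_abs]
      gcongr
      exact hC _ ⟨by linarith [hr.1], by linarith [hr.2]⟩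
    · refine .of_forall fun r _ ↦ Tendsto.const_mul _ ?_
      exact (hGc r).1.tendsto.comp (tendsto_gridCeil hδ hδ0 s r)
  have hval : ∀ N, ∫ r in s..t, deriv w r * G (gridCeil s (δ N) r) =
      ∑ j ∈ Finset.range (N + 1),
        (w (gridPt s t N (j + 1)) - w (gridPt s t N j)) * G (gridPt s t N (j + 1)) := by
    intro N
    have h0 : gridPt s t N 0 = s := by simp [gridPt]
    have h1 : gridPt s t N (N + 1) = t := by
      unfold gridPt; push_cast; field_simp; ring
    have hmono : ∀ j, gridPt s t N j ≤ gridPt s t N (j + 1) := by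
      intro j
      have := hδ N
      simp only [hδdef] at this
      unfold gridPt; push_cast; linarith
    have hcell : ∀ j, ∀ r ∈ Set.uIoc (gridPt s t N j) (gridPt s t N (j + 1)),
        deriv w r * G (gridCeil s (δ N) r) = deriv w r * G (gridPt s t N (j + 1)) := by
      intro j r hr
      rw [Set.uIoc_of_le (hmono j)] at hr
      rw [gridCeil_eq (hδ N) j hr.1 hr.2]
      rfl
    have hint : ∀ j, IntervalIntegrable (fun r ↦ deriv w r * G (gridCeil s (δ N) r)) volume
        (gridPt s t N j) (gridPt s t N (j + 1)) := by
      intro j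
      refine IntervalIntegrable.congr (f := fun r ↦ deriv w r * G (gridPt s t N (j + 1)))
        (fun r hr ↦ (hcell j r hr).symm) ?_
      exact (hc.mul continuous_const).intervalIntegrable _ _
    have := intervalIntegral.sum_integral_adjacent_intervals (n := N + 1) (fun j _ ↦ hint j)
    rw [h0, h1] at this
    rw [← this]
    refine Finset.sum_congr rfl fun j _ ↦ ?_
    rw [intervalIntegral.integral_congr_ae (.of_forall (hcell j)),
      intervalIntegral.integral_mul_const,
      integral_deriv_eq_sub_of_contDiff hw]
  simp only [hval] at hlim
  have := hlim.const_sub (w t * G t - w s * G s)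
  refine this.congr fun N ↦ ?_
  simp [stSum, hG]

/-! ### Independence of the σ-algebras generated by increments -/

theorem Finset.exists_monotone_enum {T : Type*} [LinearOrder T] [Nonempty T] (K : Finset T) :
    ∃ t : ℕ → T, Monotone t ∧ ∀ x ∈ K, ∃ i, t i = x := by
  rcases K.eq_empty_or_nonempty with rfl | hK
  · exact ⟨fun _ ↦ Classical.arbitrary T, monotone_const, by simp⟩
  have hpos : 0 < K.card := hK.card_pos
  -- Beyond the last element the enumeration repeats the maximum.
  refine ⟨fun m ↦ K.orderEmbOfFin rfl ⟨min m (K.card - 1), by omega⟩, fun a b hab ↦ ?_,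
    fun x hx ↦ ?_⟩
  · refine (K.orderEmbOfFin rfl).monotone ?_
    simp only [Fin.mk_le_mk]
    omega
  · have : x ∈ Set.range (K.orderEmbOfFin rfl) := by simpa using hx
    obtain ⟨i, rfl⟩ := this
    refine ⟨i, ?_⟩
    have hi : (⟨min (i : ℕ) (K.card - 1), by omega⟩ : Fin K.card) = i := by
      have := i.2
      ext
      simp only
      omega
    exact congrArg _ hi

namespace ProbabilityTheory

/-- A sequence of σ-algebras is independent if each one is independent of the previous ones. -/
theorem iIndep_of_indep_iSup_lt {Ω ι : Type*} [LinearOrder ι] {m0 : MeasurableSpace Ω}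
    {P : Measure Ω} [IsProbabilityMeasure P] {m : ι → MeasurableSpace Ω}
    (h : ∀ i, Indep (⨆ j < i, m j) (m i) P) : iIndep m P := by
  rw [iIndep_iff]
  intro s
  induction s using Finset.induction_on_max with
  | empty => simp
  | insert a s hs ih =>
    intro f hf
    have ha : a ∉ s := fun h ↦ lt_irrefl _ (hs a h)
    rw [Finset.set_biInter_insert, Finset.prod_insert ha, Set.inter_comm, mul_comm,
      ← ih fun i hi ↦ hf i (Finset.mem_insert_of_mem hi)]
    refine (Indep_iff _ _ _).1 (h a) _ _ ?_ (hf a (Finset.mem_insert_self _ _))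
    refine Finset.measurableSet_biInter s fun i hi ↦ ?_
    exact (le_iSup₂_of_le i (hs i hi) le_rfl : m i ≤ _) _ (hf i (Finset.mem_insert_of_mem hi))

variable {Ω T : Type*}

/-- The σ-algebra generated by the increments of `Y` between times in `S`. -/
@[reducible]
def incrSigma (Y : T → Ω → ℝ) (S : Set T) : MeasurableSpace Ω :=
  ⨆ p : S × S, MeasurableSpace.comap (fun ω ↦ Y p.2 ω - Y p.1 ω) inferInstance

theorem measurable_incrSigma (Y : T → Ω → ℝ) {S : Set T} {u v : T} (hu : u ∈ S) (hv : v ∈ S) :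
    Measurable[incrSigma Y S] fun ω ↦ Y v ω - Y u ω := by
  refine Measurable.mono (comap_measurable _) ?_ le_rfl
  exact le_iSup (fun p : S × S ↦ MeasurableSpace.comap (fun ω ↦ Y p.2 ω - Y p.1 ω) inferInstance)
    (⟨u, hu⟩, ⟨v, hv⟩)

theorem incrSigma_le_iff {Y : T → Ω → ℝ} {S : Set T} {m : MeasurableSpace Ω} :
    incrSigma Y S ≤ m ↔ ∀ u ∈ S, ∀ v ∈ S, Measurable[m] fun ω ↦ Y v ω - Y u ω := by
  constructor
  · intro h u hu v hv
    exact (measurable_incrSigma Y hu hv).mono h le_rfl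
  · intro h
    exact iSup_le fun p ↦ (h p.1 p.1.2 p.2 p.2.2).comap_le

theorem incrSigma_mono (Y : T → Ω → ℝ) {S S' : Set T} (h : S ⊆ S') :
    incrSigma Y S ≤ incrSigma Y S' :=
  incrSigma_le_iff.2 fun _ hu _ hv ↦ measurable_incrSigma Y (h hu) (h hv)

theorem incrSigma_le {m0 : MeasurableSpace Ω} {Y : T → Ω → ℝ} (hm : ∀ t, Measurable (Y t))
    (S : Set T) : incrSigma Y S ≤ m0 :=
  incrSigma_le_iff.2 fun u _ v _ ↦ (hm v).sub (hm u)

theorem incrSigma_eq_iSup_finset (Y : T → Ω → ℝ) (S : Set T) :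
    incrSigma Y S = ⨆ I : {I : Finset T // (I : Set T) ⊆ S}, incrSigma Y (I.1 : Set T) := by
  classical
  refine le_antisymm (incrSigma_le_iff.2 fun u hu v hv ↦ ?_)
    (iSup_le fun I ↦ incrSigma_mono Y I.2)
  let I : {I : Finset T // (I : Set T) ⊆ S} := ⟨{u, v}, by
    intro x hx
    simp only [Finset.coe_insert, Finset.coe_singleton, Set.mem_insert_iff,
      Set.mem_singleton_iff] at hx
    rcases hx with rfl | rfl <;> assumption⟩
  have hI : Measurable[incrSigma Y (I.1 : Set T)] fun ω ↦ Y v ω - Y u ω :=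
    measurable_incrSigma Y (by simp [I]) (by simp [I])
  exact hI.mono
    (le_iSup (fun I : {I : Finset T // (I : Set T) ⊆ S} ↦ incrSigma Y (I.1 : Set T)) I) le_rfl

theorem directed_incrSigma_finset (Y : T → Ω → ℝ) (S : Set T) :
    Directed (· ≤ ·) fun I : {I : Finset T // (I : Set T) ⊆ S} ↦ incrSigma Y (I.1 : Set T) := by
  classical
  intro I J
  refine ⟨⟨I.1 ∪ J.1, by simpa using ⟨I.2, J.2⟩⟩, incrSigma_mono Y ?_, incrSigma_mono Y ?_⟩ <;>
  simp

/-- Increments telescope along the enumeration. Degenerate cells contribute zero and may be left out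
of `A`, which later keeps the two index sets disjoint. -/
theorem incrSigma_le_iSup_comap {Y : T → Ω → ℝ} {t : ℕ → T} {S : Set T} {A : Set ℕ}
    (hS : ∀ x ∈ S, ∃ i, t i = x)
    (hA : ∀ i j, t i ∈ S → t j ∈ S → ∀ m ∈ Finset.Ico i j, t m ≠ t (m + 1) → m ∈ A) :
    incrSigma Y S ≤ ⨆ m ∈ A,
      MeasurableSpace.comap (fun ω ↦ Y (t (m + 1)) ω - Y (t m) ω) inferInstance := by
  have key : ∀ i j, i ≤ j → t i ∈ S → t j ∈ S →
      Measurable[⨆ m ∈ A, MeasurableSpace.comap (fun ω ↦ Y (t (m + 1)) ω - Y (t m) ω)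
        inferInstance] fun ω ↦ Y (t j) ω - Y (t i) ω := by
    intro i j hij hi hj
    have : (fun ω ↦ Y (t j) ω - Y (t i) ω) =
        fun ω ↦ ∑ m ∈ Finset.Ico i j, (Y (t (m + 1)) ω - Y (t m) ω) := by
      funext ω
      rw [Finset.sum_Ico_sub (fun m ↦ Y (t m) ω) hij]
    rw [this]
    refine Finset.measurable_sum _ fun m hm ↦ ?_
    by_cases hne : t m = t (m + 1)
    · simp only [hne, sub_self]
      exact measurable_const
    · exact (comap_measurable _).mono
        (le_iSup₂_of_le m (hA i j hi hj m hm hne) le_rfl) le_rfl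
  refine incrSigma_le_iff.2 fun u hu v hv ↦ ?_
  obtain ⟨i, rfl⟩ := hS u hu
  obtain ⟨j, rfl⟩ := hS v hv
  rcases le_total i j with hij | hij
  · exact key i j hij hu hv
  · have := (key j i hij hv hu).neg
    simpa only [Pi.neg_def, neg_sub] using this

/-- Directed suprema reduce both sides to finite sets `I` and `J`. Along an enumeration of `I ∪ J`,
increments of `I` use cells ending before a point of `I`, those of `J` cells starting after a point
of `J`; no nondegenerate cell does both. -/
theorem HasIndepIncrements.indep_incrSigma [LinearOrder T] [Nonempty T]
    {m0 : MeasurableSpace Ω} {P : Measure Ω}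
    [IsProbabilityMeasure P]
    {Y : T → Ω → ℝ} (hY : HasIndepIncrements Y P) (hm : ∀ t, Measurable (Y t)) {S S' : Set T}
    (hS : ∀ x ∈ S, ∀ y ∈ S', x ≤ y) : Indep (incrSigma Y S) (incrSigma Y S') P := by
  classical
  have hle := incrSigma_le hm
  rw [incrSigma_eq_iSup_finset Y S]
  refine indep_iSup_of_directed_le (fun I ↦ ?_) (fun I ↦ hle _) (hle _)
    (directed_incrSigma_finset Y S)
  refine Indep.symm ?_
  rw [incrSigma_eq_iSup_finset Y S']
  refine indep_iSup_of_directed_le (fun J ↦ ?_) (fun I ↦ hle _) (hle _)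
    (directed_incrSigma_finset Y S')
  refine Indep.symm ?_
  obtain ⟨t, ht, htK⟩ := (I.1 ∪ J.1).exists_monotone_enum
  have hind := (hY.nat ht).iIndep
  have hd : Disjoint {m : ℕ | t m ≠ t (m + 1) ∧ ∃ v ∈ I.1, t (m + 1) ≤ v}
      {m : ℕ | t m ≠ t (m + 1) ∧ ∃ u ∈ J.1, u ≤ t m} := by
    rw [Set.disjoint_left]
    rintro m ⟨hne, v, hv, hmv⟩ ⟨_, u, hu, hum⟩
    exact hne (le_antisymm (ht (Nat.le_succ m))
      ((hmv.trans (hS v (I.2 hv) u (J.2 hu))).trans hum))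
  refine indep_of_indep_of_le (indep_iSup_of_disjoint
    (fun m ↦ ((hm _).sub (hm _)).comap_le) hind hd) ?_ ?_
  · refine incrSigma_le_iSup_comap (fun x hx ↦ htK x (Finset.mem_union_left _ hx))
      fun i j _ hj m hmem hne ↦ ⟨hne, t j, hj, ht ?_⟩
    have := (Finset.mem_Ico.1 hmem).2
    omega
  · refine incrSigma_le_iSup_comap (fun x hx ↦ htK x (Finset.mem_union_right _ hx))
      fun i j hi _ m hmem hne ↦ ⟨hne, t i, hi, ht (Finset.mem_Ico.1 hmem).1⟩

/-- Both orders are admitted: the increments of `backLevy` use consecutive intervals in increasing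
order, whereas those of `satoIntegral` run backwards through the logarithmic time change. -/
theorem HasIndepIncrements.iIndepFun_of_incrSigma [LinearOrder T] [Nonempty T]
    {m0 : MeasurableSpace Ω} {P : Measure Ω} [IsProbabilityMeasure P] {Y : T → Ω → ℝ}
    (hY : HasIndepIncrements Y P) (hm : ∀ t, Measurable (Y t)) {ι : Type*} [LinearOrder ι] {S : ι → Set T}
    (hS : (∀ i, ∀ j < i, ∀ x ∈ S j, ∀ y ∈ S i, x ≤ y) ∨ ∀ i, ∀ j < i, ∀ x ∈ S j, ∀ y ∈ S i, y ≤ x)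
    {V : ι → Ω → ℝ} (hV : ∀ i, AEStronglyMeasurable[incrSigma Y (S i)] (V i) P) :
    iIndepFun V P := by
  have hI : iIndep (fun i ↦ incrSigma Y (S i)) P := by
    refine iIndep_of_indep_iSup_lt fun i ↦ ?_
    refine indep_of_indep_of_le_left (m₁ := incrSigma Y (⋃ j < i, S j)) ?_
      (iSup₂_le fun j hj ↦ incrSigma_mono Y (Set.subset_biUnion_of_mem (u := S) hj))
    rcases hS with hS | hS
    · refine hY.indep_incrSigma hm fun x hx y hy ↦ ?_
      obtain ⟨j, hj, hx⟩ := Set.mem_iUnion₂.1 hx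
      exact hS i j hj x hx y hy
    · refine (hY.indep_incrSigma hm fun y hy x hx ↦ ?_).symm
      obtain ⟨j, hj, hx⟩ := Set.mem_iUnion₂.1 hx
      exact hS i j hj x hx y hy
  refine iIndepFun.congr (fun i ↦ (hV i).choose_spec.2.symm) ?_
  rw [iIndepFun_iff_iIndep]
  exact iIndep_of_iIndep_of_le hI fun i ↦ (hV i).choose_spec.1.measurable.comap_le

theorem HasIndepIncrements.congr {T : Type*} [Preorder T] {m0 : MeasurableSpace Ω} {P : Measure Ω}
    {Y Y' : T → Ω → ℝ} (hY : HasIndepIncrements Y P) (h : ∀ t, Y t =ᵐ[P] Y' t) :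
    HasIndepIncrements Y' P :=
  fun n t ht ↦ (hY n t ht).congr fun _ ↦ (h _).sub (h _)

/-- Time reversal reverses the list of increments and changes their signs; neither affects
independence. -/
theorem HasIndepIncrements.comp_antitone {T T' : Type*} [Preorder T] [Preorder T']
    {m0 : MeasurableSpace Ω} {P : Measure Ω} {Y : T → Ω → ℝ}
    (hY : HasIndepIncrements Y P) {φ : T' → T} (hφ : Antitone φ) :
    HasIndepIncrements (fun t ↦ Y (φ t)) P := by
  intro n t ht
  have h := hY n (fun i ↦ φ (t i.rev)) fun i j hij ↦ hφ (ht (Fin.rev_le_rev.2 hij))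
  have h2 := (h.precomp (g := Fin.rev) Fin.rev_injective).comp (fun _ x ↦ -x)
    fun _ ↦ measurable_neg
  convert h2 using 3 with i
  simp [Fin.rev_succ, Fin.rev_castSucc]

end ProbabilityTheory

/-- An almost sure limit of functions measurable with respect to a σ-algebra, up to null sets, has
the same property. -/
theorem MeasureTheory.aestronglyMeasurable_of_tendsto_ae' {Ω : Type*} {m0 m : MeasurableSpace Ω}
    {P : Measure[m0] Ω} {U : ℕ → Ω → ℝ} {V : Ω → ℝ} (hU : ∀ n, AEStronglyMeasurable[m] (U n) P)
    (h : ∀ᵐ ω ∂P, Tendsto (fun n ↦ U n ω) atTop (𝓝 (V ω))) : AEStronglyMeasurable[m] V P := by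
  refine ⟨fun ω ↦ limUnder atTop fun n ↦ (hU n).choose ω,
    StronglyMeasurable.limUnder fun n ↦ (hU n).choose_spec.1, ?_⟩
  filter_upwards [h, ae_all_iff.2 fun n ↦ (hU n).choose_spec.2] with ω h1 h2
  simp only [← h2]
  exact h1.limUnder_eq.symm

/-- Almost sure limits of identically distributed sequences are identically distributed. -/
theorem ProbabilityTheory.IdentDistrib.of_tendsto_ae {Ω Ω' E : Type*} [MeasurableSpace Ω]
    [MeasurableSpace Ω'] {P : Measure Ω} {P' : Measure Ω'} [IsProbabilityMeasure P]
    [IsProbabilityMeasure P'] [TopologicalSpace E] [TopologicalSpace.PseudoMetrizableSpace E]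
    [MeasurableSpace E] [BorelSpace E] {U : ℕ → Ω → E} {U' : ℕ → Ω' → E} {V : Ω → E} {V' : Ω' → E}
    (h : ∀ n, IdentDistrib (U n) (U' n) P P')
    (hV : ∀ᵐ ω ∂P, Tendsto (fun n ↦ U n ω) atTop (𝓝 (V ω)))
    (hV' : ∀ᵐ ω ∂P', Tendsto (fun n ↦ U' n ω) atTop (𝓝 (V' ω))) : IdentDistrib V V' P P' := by
  have hm : AEMeasurable V P :=
    aemeasurable_of_tendsto_metrizable_ae _ (fun n ↦ (h n).aemeasurable_fst) hV
  have hm' : AEMeasurable V' P' :=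
    aemeasurable_of_tendsto_metrizable_ae _ (fun n ↦ (h n).aemeasurable_snd) hV'
  refine ⟨hm, hm', ?_⟩
  have := Measure.isProbabilityMeasure_map hm
  have := Measure.isProbabilityMeasure_map hm'
  refine ext_of_forall_integral_eq_of_IsFiniteMeasure fun f ↦ ?_
  have hf := f.continuous
  rw [integral_map hm hf.aestronglyMeasurable, integral_map hm' hf.aestronglyMeasurable]
  have lim : Tendsto (fun n ↦ ∫ ω, f (U n ω) ∂P) atTop (𝓝 (∫ ω, f (V ω) ∂P)) := by
    refine tendsto_integral_of_dominated_convergence (fun _ ↦ ‖f‖)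
      (fun n ↦ (hf.measurable.comp_aemeasurable (h n).aemeasurable_fst).aestronglyMeasurable)
      (integrable_const _) (fun n ↦ .of_forall fun ω ↦ f.norm_coe_le_norm _) ?_
    filter_upwards [hV] with ω hω using (hf.tendsto _).comp hω
  have lim' : Tendsto (fun n ↦ ∫ ω, f (U' n ω) ∂P') atTop (𝓝 (∫ ω, f (V' ω) ∂P')) := by
    refine tendsto_integral_of_dominated_convergence (fun _ ↦ ‖f‖)
      (fun n ↦ (hf.measurable.comp_aemeasurable (h n).aemeasurable_snd).aestronglyMeasurable)
      (integrable_const _) (fun n ↦ .of_forall fun ω ↦ f.norm_coe_le_norm _) ?_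
    filter_upwards [hV'] with ω hω using (hf.tendsto _).comp hω
  refine tendsto_nhds_unique lim (lim'.congr fun n ↦ ?_)
  exact (((h n).comp hf.measurable).integral_eq).symm

/-! ### Stieltjes integrals along the paths of a process -/

/-- Two versions are needed: `Y` has càdlàg paths, while a measurable version `Y'`, whose paths may
be irregular, generates a σ-algebra inside the ambient one. The approximating sums agree almost
surely. -/
theorem aestronglyMeasurable_stInt {Ω : Type*} [m0 : MeasurableSpace Ω] {P : Measure Ω}
    {w : ℝ → ℝ} (hw : ContDiff ℝ 1 w) {Y Y' : ℝ → Ω → ℝ} (hYY' : ∀ t, Y t =ᵐ[P] Y' t)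
    (hc : ∀ᵐ ω ∂P, IsCadlag fun s ↦ Y s ω) {s t : ℝ} (hst : s ≤ t) {S : Set ℝ}
    (hS : Set.Icc s t ⊆ S) :
    AEStronglyMeasurable[incrSigma Y' S] (fun ω ↦ stInt w (fun s ↦ Y s ω) s t) P := by
  refine aestronglyMeasurable_of_tendsto_ae' (U := fun N ω ↦ stSum w (fun s ↦ Y s ω) s t N)
    (fun N ↦ ?_) (hc.mono fun ω hω ↦ tendsto_stSum hw hω hst)
  have hs : s ∈ S := hS ⟨le_rfl, hst⟩
  have ht : t ∈ S := hS ⟨hst, le_rfl⟩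
  refine ⟨fun ω ↦ stSum w (fun s ↦ Y' s ω) s t N, Measurable.stronglyMeasurable ?_, ?_⟩
  · unfold stSum
    refine ((measurable_incrSigma Y' hs ht).const_mul _).sub (Finset.measurable_sum _ fun j hj ↦ ?_)
    exact (measurable_incrSigma Y' hs (hS (gridPt_mem hst
      (by have := Finset.mem_range.1 hj; omega)))).const_mul _
  · filter_upwards [hYY' s, hYY' t, ae_all_iff.2 fun j ↦ hYY' (gridPt s t N j)] with ω h1 h2 h3
    simp [stSum, h1, h2, h3]

theorem identDistrib_stInt {Ω : Type*} [m0 : MeasurableSpace Ω] {P : Measure Ω}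
    [IsProbabilityMeasure P]
    {w : ℝ → ℝ} (hw : ContDiff ℝ 1 w) {Y Z : ℝ → Ω → ℝ}
    (h : ∀ I : Finset ℝ, IdentDistrib (fun ω (r : I) ↦ Y r ω) (fun ω (r : I) ↦ Z r ω) P P)
    (hY : ∀ᵐ ω ∂P, IsCadlag fun s ↦ Y s ω) (hZ : ∀ᵐ ω ∂P, IsCadlag fun s ↦ Z s ω)
    {ι : Type*} [Fintype ι] {s t : ι → ℝ} (hst : ∀ i, s i ≤ t i) :
    IdentDistrib (fun ω i ↦ stInt w (fun r ↦ Y r ω) (s i) (t i))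
      (fun ω i ↦ stInt w (fun r ↦ Z r ω) (s i) (t i)) P P := by
  classical
  refine IdentDistrib.of_tendsto_ae
    (U := fun N ω i ↦ stSum w (fun r ↦ Y r ω) (s i) (t i) N)
    (U' := fun N ω i ↦ stSum w (fun r ↦ Z r ω) (s i) (t i) N) (fun N ↦ ?_)
    (hY.mono fun ω hω ↦ tendsto_pi_nhds.2 fun i ↦ tendsto_stSum hw hω (hst i))
    (hZ.mono fun ω hω ↦ tendsto_pi_nhds.2 fun i ↦ tendsto_stSum hw hω (hst i))
  -- All times entering the `N`-th sums, so that these are one measurable function of the vector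
  -- indexed by `I`; `ext` pads with an irrelevant zero off `I`.
  let I : Finset ℝ := Finset.univ.image s ∪ Finset.univ.image t ∪
    (Finset.univ ×ˢ Finset.range (N + 2)).image fun p ↦ gridPt (s p.1) (t p.1) N p.2
  let ext : (I → ℝ) → ℝ → ℝ := fun v r ↦ if hr : r ∈ I then v ⟨r, hr⟩ else 0
  have hext : ∀ r, Measurable fun v ↦ ext v r := by
    intro r
    by_cases hr : r ∈ I
    · simp only [ext, hr, dite_true]; exact measurable_pi_apply _
    · simp only [ext, hr, dite_false]; exact measurable_const
  have hu : Measurable fun (v : I → ℝ) i ↦ stSum w (ext v) (s i) (t i) N := by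
    refine measurable_pi_lambda _ fun i ↦ ?_
    unfold stSum
    exact (((hext _).sub (hext _)).const_mul _).sub
      (Finset.measurable_sum _ fun j _ ↦ ((hext _).sub (hext _)).const_mul _)
  have hs : ∀ i, s i ∈ I := fun i ↦ by simp [I]
  have ht : ∀ i, t i ∈ I := fun i ↦ by simp [I]
  have hg : ∀ i, ∀ j ∈ Finset.range (N + 1), gridPt (s i) (t i) N (j + 1) ∈ I := fun i j hj ↦ by
    refine Finset.mem_union_right _ (Finset.mem_image.2 ⟨(i, j + 1), ?_, rfl⟩)
    simp at hj ⊢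
    omega
  have key : ∀ (Y : ℝ → Ω → ℝ) ω i, stSum w (ext fun r : I ↦ Y r ω) (s i) (t i) N =
      stSum w (fun r ↦ Y r ω) (s i) (t i) N := by
    intro Y ω i
    unfold stSum
    congr 1
    · simp [ext, hs i, ht i]
    · refine Finset.sum_congr rfl fun j hj ↦ ?_
      simp [ext, hs i, hg i j hj]
  have := (h I).comp hu
  convert this using 1
  · funext ω i; exact (key Y ω i).symm
  · funext ω i; exact (key Z ω i).symm

/-! ### Finite-dimensional distributions of a two-sided Lévy process -/

theorem IsDoubleSidedLevy.identDistrib_shift {Ω : Type*} [MeasurableSpace Ω] {P : Measure Ω}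
    [IsProbabilityMeasure P] {Y : ℝ → Ω → ℝ} (hY : IsDoubleSidedLevy Y P) (h : ℝ) (I : Finset ℝ) :
    IdentDistrib (fun ω (r : I) ↦ Y (r + h) ω - Y h ω) (fun ω (r : I) ↦ Y r ω) P P := by
  classical
  -- Including `0` makes each `Y r - Y 0` a difference of partial sums of consecutive increments,
  -- whose joint law is shift-invariant.
  obtain ⟨t, ht, htI⟩ := (insert 0 I).exists_monotone_enum
  obtain ⟨k, hk⟩ := htI 0 (Finset.mem_insert_self _ _)
  choose i hi using fun r : I ↦ htI r (Finset.mem_insert_of_mem r.2)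
  have hpi := IdentDistrib.pi (μ := P) (ν := P)
    (X := fun (m : ℕ) ω ↦ Y (t (m + 1) + h) ω - Y (t m + h) ω)
    (Y := fun (m : ℕ) ω ↦ Y (t (m + 1)) ω - Y (t m) ω)
    (fun m ↦ hY.stationary _ _ h (ht (Nat.le_succ m)))
    (hY.indep.nat (t := fun m ↦ t m + h) fun a b hab ↦ by simpa using ht hab)
    (hY.indep.nat ht)
  have hu : Measurable fun (d : ℕ → ℝ) (r : I) ↦
      ∑ m ∈ Finset.range (i r), d m - ∑ m ∈ Finset.range k, d m := by
    refine measurable_pi_lambda _ fun r ↦ ?_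
    exact (Finset.measurable_sum _ fun m _ ↦ measurable_pi_apply m).sub
      (Finset.measurable_sum _ fun m _ ↦ measurable_pi_apply m)
  have h1 := hpi.comp hu
  have e1 : (fun (d : ℕ → ℝ) (r : I) ↦
      ∑ m ∈ Finset.range (i r), d m - ∑ m ∈ Finset.range k, d m) ∘
      (fun ω (m : ℕ) ↦ Y (t (m + 1) + h) ω - Y (t m + h) ω) =
      fun ω (r : I) ↦ Y (r + h) ω - Y h ω := by
    funext ω r
    simp only [Function.comp]
    rw [Finset.sum_range_sub (fun m ↦ Y (t m + h) ω),
      Finset.sum_range_sub (fun m ↦ Y (t m + h) ω), hi, hk]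
    simp
  have e2 : (fun (d : ℕ → ℝ) (r : I) ↦
      ∑ m ∈ Finset.range (i r), d m - ∑ m ∈ Finset.range k, d m) ∘
      (fun ω (m : ℕ) ↦ Y (t (m + 1)) ω - Y (t m) ω) =
      fun ω (r : I) ↦ Y r ω - Y 0 ω := by
    funext ω r
    simp only [Function.comp]
    rw [Finset.sum_range_sub (fun m ↦ Y (t m) ω),
      Finset.sum_range_sub (fun m ↦ Y (t m) ω), hi, hk]
    simp
  rw [e1, e2] at h1
  refine h1.trans (IdentDistrib.of_ae_eq h1.aemeasurable_snd ?_)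
  filter_upwards [hY.zero] with ω hω
  funext r
  simp [hω]

/-- A process of a.e. measurable random variables has a version of measurable ones. -/
theorem exists_measurable_version {Ω T : Type*} [MeasurableSpace Ω] {P : Measure Ω}
    {Y : T → Ω → ℝ} (hY : ∀ t, AEMeasurable (Y t) P) :
    ∃ Y' : T → Ω → ℝ, (∀ t, Measurable (Y' t)) ∧ ∀ t, Y t =ᵐ[P] Y' t :=
  ⟨fun t ↦ (hY t).mk, fun t ↦ (hY t).measurable_mk, fun t ↦ (hY t).ae_eq_mk⟩

/-! ### One-sided limits of one-sided limits -/

/-- `rightLim` at `c` is always a cluster value of `f` near `c`, so it stays in every closed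
neighbourhood of `l` that contains the values of `f` around `c`. -/
theorem tendsto_rightLim_nhdsLT {f : ℝ → ℝ} {a l : ℝ} (h : Tendsto f (𝓝[<] a) (𝓝 l)) :
    Tendsto f.rightLim (𝓝[<] a) (𝓝 l) := by
  refine (closed_nhds_basis l).tendsto_right_iff.2 fun s ⟨hs, hsc⟩ ↦ ?_
  obtain ⟨u, hu, hus⟩ := (mem_nhdsLT_iff_exists_Ioo_subset).1 (h hs)
  filter_upwards [Ioo_mem_nhdsLT hu] with c hc
  refine hsc.mem_of_mapClusterPt (mapClusterPt_rightLim f c) ?_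
  exact mem_nhdsWithin_of_mem_nhds (mem_of_superset (Ioo_mem_nhds hc.1 hc.2) hus)

theorem tendsto_leftLim_nhdsGT {f : ℝ → ℝ} {a l : ℝ} (h : Tendsto f (𝓝[>] a) (𝓝 l)) :
    Tendsto f.leftLim (𝓝[>] a) (𝓝 l) := by
  refine (closed_nhds_basis l).tendsto_right_iff.2 fun s ⟨hs, hsc⟩ ↦ ?_
  obtain ⟨u, hu, hus⟩ := (mem_nhdsGT_iff_exists_Ioo_subset).1 (h hs)
  filter_upwards [Ioo_mem_nhdsGT hu] with c hc
  refine hsc.mem_of_mapClusterPt (mapClusterPt_leftLim f c) ?_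
  exact mem_nhdsWithin_of_mem_nhds (mem_of_superset (Ioo_mem_nhds hc.1 hc.2) hus)

/-! ### Further properties of the pathwise Stieltjes integral -/

theorem stInt_self (w g : ℝ → ℝ) (s : ℝ) : stInt w g s s = 0 := by simp [stInt]

theorem stInt_comp_add (w g : ℝ → ℝ) (s t h : ℝ) :
    stInt (fun r ↦ w (r + h)) (fun r ↦ g (r + h)) s t = stInt w g (s + h) (t + h) := by
  unfold stInt
  simp only [deriv_comp_add_const]
  rw [intervalIntegral.integral_comp_add_right (fun r ↦ deriv w r * g r)]

theorem stInt_const_mul_left (w g : ℝ → ℝ) (c s t : ℝ) :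
    stInt (fun r ↦ c * w r) g s t = c * stInt w g s t := by
  unfold stInt
  simp only [deriv_const_mul_field, mul_assoc, intervalIntegral.integral_const_mul]
  ring

theorem continuous_integral_deriv_mul {w g : ℝ → ℝ} (hw : ContDiff ℝ 1 w) (hg : IsCadlag g)
    (c : ℝ) : Continuous fun s ↦ ∫ r in c..s, deriv w r * g r :=
  intervalIntegral.continuous_primitive
    (fun a b ↦ hg.intervalIntegrable (hw.continuous_deriv le_rfl) a b) c

theorem tendsto_stInt_nhdsLT {w g : ℝ → ℝ} (hw : ContDiff ℝ 1 w) (hg : IsCadlag g) (c a : ℝ) :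
    Tendsto (stInt w g c) (𝓝[<] a)
      (𝓝 (w a * g.leftLim a - w c * g c - ∫ r in c..a, deriv w r * g r)) :=
  (((hw.continuous.tendsto a).mono_left nhdsWithin_le_nhds).mul (hg.tendsto_leftLim a)
    |>.sub_const _).sub
    (((continuous_integral_deriv_mul hw hg c).tendsto a).mono_left nhdsWithin_le_nhds)

theorem isCadlag_stInt {w g : ℝ → ℝ} (hw : ContDiff ℝ 1 w) (hg : IsCadlag g) (c : ℝ) :
    IsCadlag (stInt w g c) := by
  refine fun a ↦ ⟨?_, _, tendsto_stInt_nhdsLT hw hg c a⟩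
  exact ((hw.continuous.continuousWithinAt.mul (hg a).1).sub continuousWithinAt_const).sub
    (continuous_integral_deriv_mul hw hg c).continuousWithinAt

theorem contDiff_exp_neg : ContDiff ℝ 1 fun s : ℝ ↦ Real.exp (-s) :=
  Real.contDiff_exp.comp contDiff_neg

theorem hasDerivAt_exp_neg (s : ℝ) :
    HasDerivAt (fun s : ℝ ↦ Real.exp (-s)) (-Real.exp (-s)) s := by
  have := (hasDerivAt_neg s).exp
  simpa using this

theorem deriv_exp_neg (s : ℝ) : deriv (fun s : ℝ ↦ Real.exp (-s)) s = -Real.exp (-s) :=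
  (hasDerivAt_exp_neg s).deriv

/-- If `dy = -e^s dg`, then `∫_{[a, b]} e^{-s} dy(s) = g(a-) - g(b)`. -/
theorem pathIntegral_exp_neg_stInt_exp {g : ℝ → ℝ} (hg : IsCadlag g) (a b : ℝ) :
    pathIntegral (fun s ↦ Real.exp (-s)) (fun s ↦ -stInt Real.exp g 0 s) a b =
      g.leftLim a - g b := by
  have hexp : ContDiff ℝ 1 Real.exp := Real.contDiff_exp
  have hleft : Function.leftLim (fun s ↦ -stInt Real.exp g 0 s) a =
      -(Real.exp a * g.leftLim a - Real.exp 0 * g 0 - ∫ r in (0 : ℝ)..a, deriv Real.exp r * g r) :=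
    leftLim_eq_of_tendsto (tendsto_stInt_nhdsLT hexp hg 0 a).neg
  set F : ℝ → ℝ := fun s ↦ ∫ r in (0 : ℝ)..s, deriv Real.exp r * g r with hF
  have hFc : Continuous F := continuous_integral_deriv_mul hexp hg 0
  -- An explicit primitive of the by-parts integrand. Only right derivatives are available, since
  -- `g` is merely right-continuous.
  have hder : ∀ x, HasDerivWithinAt (fun s ↦ Real.exp (-s) * (F s + g 0))
      (deriv (fun s : ℝ ↦ Real.exp (-s)) x * -stInt Real.exp g 0 x) (Set.Ioi x) x := by
    intro x
    have h1 : HasDerivWithinAt F (deriv Real.exp x * g x) (Set.Ioi x) x := by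
      refine (intervalIntegral.integral_hasDerivWithinAt_right (s := Set.Ici x) (t := Set.Ioi x)
        (hg.intervalIntegrable (hexp.continuous_deriv le_rfl) 0 x) ?_ ?_).mono
        Set.Ioi_subset_Ici_self
      · exact ((hexp.continuous_deriv le_rfl).measurable.mul
          hg.measurable).stronglyMeasurable.stronglyMeasurableAtFilter
      · exact ((hexp.continuous_deriv le_rfl).continuousWithinAt.mul (hg x).1).mono
          Set.Ioi_subset_Ici_self
    have h2 : HasDerivWithinAt (fun s : ℝ ↦ Real.exp (-s)) (-Real.exp (-x)) (Set.Ioi x) x :=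
      (hasDerivAt_exp_neg x).hasDerivWithinAt
    refine (h2.mul (h1.add_const (g 0))).congr_deriv ?_
    rw [deriv_exp_neg]
    have hx : stInt Real.exp g 0 x = Real.exp x * g x - g 0 - F x := by
      simp only [stInt, Real.exp_zero, one_mul]
      rfl
    rw [hx, Real.deriv_exp]
    ring
  have hint := intervalIntegral.integral_eq_sub_of_hasDeriv_right (a := a) (b := b)
    (f := fun s ↦ Real.exp (-s) * (F s + g 0))
    (f' := fun x ↦ deriv (fun s : ℝ ↦ Real.exp (-s)) x * -stInt Real.exp g 0 x)
    (by fun_prop) (fun x _ ↦ hder x)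
    ((isCadlag_stInt hexp hg 0).neg.intervalIntegrable
      (contDiff_exp_neg.continuous_deriv le_rfl) a b)
  have ha : Real.exp (-a) * Real.exp a = 1 := by rw [← Real.exp_add]; simp
  have hb : Real.exp (-b) * Real.exp b = 1 := by rw [← Real.exp_add]; simp
  unfold pathIntegral
  rw [hleft, hint]
  simp only [stInt, Real.exp_zero]
  change Real.exp (-b) * -(Real.exp b * g b - 1 * g 0 - F b) -
    Real.exp (-a) * -(Real.exp a * g.leftLim a - 1 * g 0 - F a) - _ = _
  linear_combination (g.leftLim a) * ha - g b * hb

/-- The boundary terms give `C e^s + C` and the integral `C (e^s - 1)`. -/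
theorem abs_stInt_exp_le {g : ℝ → ℝ} {C : ℝ} (hC : ∀ s, 0 ≤ s → |g s| ≤ C) {s : ℝ} (hs : 0 ≤ s) :
    |stInt Real.exp g 0 s| ≤ 2 * C * Real.exp s := by
  have h1 : |∫ r in (0 : ℝ)..s, deriv Real.exp r * g r| ≤ ∫ r in (0 : ℝ)..s, Real.exp r * C := by
    rw [← Real.norm_eq_abs]
    refine intervalIntegral.norm_integral_le_of_norm_le hs (.of_forall fun r hr ↦ ?_)
      (by apply Continuous.intervalIntegrable; fun_prop)
    rw [norm_mul, Real.deriv_exp, Real.norm_eq_abs, Real.norm_eq_abs, Real.abs_exp]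
    gcongr
    exact hC r hr.1.le
  rw [intervalIntegral.integral_mul_const, integral_exp, Real.exp_zero] at h1
  have h2 : |Real.exp s * g s| ≤ Real.exp s * C := by
    rw [abs_mul, Real.abs_exp]
    gcongr
    exact hC s hs
  have h3 := hC 0 le_rfl
  unfold stInt
  rw [Real.exp_zero, one_mul]
  rw [abs_le] at *
  constructor <;> nlinarith

/-! ### A converse to the first moment bound on tails -/

/-- A nonnegative `f` is at most `⌈f⌉₊`, which counts the natural numbers `n < f`. -/
theorem integrable_of_tsum_measure_lt_top {Ω : Type*} [MeasurableSpace Ω] {P : Measure Ω}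
    {f : Ω → ℝ} (hf : AEMeasurable f P) (h0 : 0 ≤ f)
    (h : ∑' n : ℕ, P {ω | (n : ℝ) < f ω} ≠ ⊤) : Integrable f P := by
  refine ⟨hf.aestronglyMeasurable, ?_⟩
  rw [hasFiniteIntegral_iff_ofReal (.of_forall h0)]
  have hm : ∀ n : ℕ, NullMeasurableSet {ω | (n : ℝ) < f ω} P := fun n ↦
    nullMeasurableSet_lt aemeasurable_const hf
  have hle : ∀ ω, ENNReal.ofReal (f ω) ≤
      ∑' n : ℕ, Set.indicator {ω | (n : ℝ) < f ω} (1 : Ω → ENNReal) ω := by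
    intro ω
    calc ENNReal.ofReal (f ω) ≤ (⌈f ω⌉₊ : ENNReal) := by
          rw [← ENNReal.ofReal_natCast]
          exact ENNReal.ofReal_le_ofReal (Nat.le_ceil _)
      _ = ∑ n ∈ Finset.range ⌈f ω⌉₊,
            Set.indicator {ω | (n : ℝ) < f ω} (1 : Ω → ENNReal) ω := by
          rw [Finset.sum_congr rfl (g := fun _ ↦ (1 : ENNReal))]
          · simp
          · intro n hn
            have hmem : ω ∈ {ω | (n : ℝ) < f ω} := Nat.lt_ceil.1 (Finset.mem_range.1 hn)
            rw [Set.indicator_of_mem hmem, Pi.one_apply]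
      _ ≤ _ := ENNReal.sum_le_tsum _
  refine lt_of_le_of_lt (lintegral_mono hle) ?_
  rw [lintegral_tsum (f := fun n : ℕ ↦ Set.indicator {ω | (n : ℝ) < f ω} (1 : Ω → ENNReal))
    fun n ↦ measurable_one.aemeasurable.indicator₀ (hm n)]
  simp only [lintegral_indicator_one₀ (hm _)]
  exact lt_top_iff_ne_top.2 h

theorem lt_posLog_abs_iff {c x : ℝ} (hc : 0 ≤ c) : c < Real.posLog |x| ↔ Real.exp c < |x| := by
  rw [show Real.posLog |x| = max 0 (Real.log |x|) from rfl, lt_max_iff]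
  constructor
  · rintro (h | h)
    · exact absurd h (not_lt.2 hc)
    · rcases (abs_nonneg x).eq_or_lt with h0 | h0
      · rw [← h0, Real.log_zero] at h; exact absurd h (not_lt.2 hc)
      · exact (Real.lt_log_iff_exp_lt h0).1 h
  · intro h
    exact Or.inr ((Real.lt_log_iff_exp_lt ((Real.exp_pos c).trans h)).2 h)

/-- A converse Borel–Cantelli lemma: if independent random variables are eventually outside given
sets, the probabilities of these sets are summable. -/
theorem ProbabilityTheory.iIndepFun.tsum_measure_ne_top {Ω : Type*} [MeasurableSpace Ω]
    {P : Measure Ω} {d : ℕ → Ω → ℝ} (hd : iIndepFun d P) (hm : ∀ n, AEMeasurable (d n) P)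
    {B : ℕ → Set ℝ} (hB : ∀ n, MeasurableSet (B n))
    (h : ∀ᵐ ω ∂P, ∀ᶠ n in atTop, d n ω ∉ B n) : ∑' n, P (d n ⁻¹' B n) ≠ ⊤ := by
  have := hd.isProbabilityMeasure
  obtain ⟨d', hd', hdd'⟩ := exists_measurable_version hm
  have hind : iIndepFun d' P := hd.congr hdd'
  have hset : iIndepSet (fun n ↦ d' n ⁻¹' B n) P := by
    rw [iIndepSet_iff_meas_biInter fun n ↦ hd' n (hB n)]
    intro s
    exact hind.meas_biInter fun i _ ↦ ⟨B i, hB i, rfl⟩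
  intro htop
  have heq : ∀ n, P (d n ⁻¹' B n) = P (d' n ⁻¹' B n) := fun n ↦
    measure_congr ((hdd' n).mono fun ω hω ↦ by
      simp only [eq_iff_iff]
      change d n ω ∈ B n ↔ d' n ω ∈ B n
      rw [hω])
  simp only [heq] at htop
  have h1 := measure_limsup_eq_one (fun n ↦ hd' n (hB n)) hset htop
  have h0 : P (limsup (fun n ↦ d' n ⁻¹' B n) atTop) = 0 := by
    rw [measure_eq_zero_iff_ae_notMem]
    filter_upwards [h, ae_all_iff.2 hdd'] with ω h1 h2
    rw [mem_limsup_iff_frequently_mem, not_frequently]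
    filter_upwards [h1] with n hn
    change ¬ d' n ω ∈ B n
    rwa [← h2 n]
  rw [h0] at h1
  exact zero_ne_one h1

/-! ### The exponential time change -/

/-- The time `e^{-s/H}`, whose logarithmic transform `ln (t^{-H})` is `s`. -/
noncomputable def expTime (H s : ℝ) : ℝ≥0 := ⟨Real.exp (-s / H), (Real.exp_pos _).le⟩

theorem coe_expTime (H s : ℝ) : (expTime H s : ℝ) = Real.exp (-s / H) := rfl

theorem expTime_pos (H s : ℝ) : 0 < expTime H s := Real.exp_pos _

theorem strictAnti_expTime {H : ℝ} (hH : 0 < H) : StrictAnti (expTime H) := by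
  intro s t h
  rw [← NNReal.coe_lt_coe, coe_expTime, coe_expTime, Real.exp_lt_exp]
  gcongr

theorem continuous_expTime (H : ℝ) : Continuous (expTime H) := by
  refine Continuous.subtype_mk ?_ _
  fun_prop

theorem tendsto_expTime_atTop {H : ℝ} (hH : 0 < H) : Tendsto (expTime H) atTop (𝓝 0) := by
  rw [← NNReal.tendsto_coe]
  refine Real.tendsto_exp_atBot.comp ?_
  exact tendsto_neg_atTop_atBot.atBot_div_const hH

theorem expTime_add (H s h : ℝ) : expTime H (s + h) = expTime H h * expTime H s := by
  apply NNReal.coe_injective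
  rw [NNReal.coe_mul, coe_expTime, coe_expTime, coe_expTime, ← Real.exp_add]
  ring_nf

theorem expTime_rpow {H : ℝ} (hH : 0 < H) (h : ℝ) : (expTime H h : ℝ) ^ H = Real.exp (-h) := by
  rw [coe_expTime, ← Real.exp_mul]
  field_simp

theorem log_rpow_neg {t : ℝ≥0} (ht : 0 < t) (H : ℝ) :
    Real.log ((t : ℝ) ^ (-H)) = -H * Real.log t :=
  Real.log_rpow (NNReal.coe_pos.2 ht) _

theorem expTime_log_rpow_neg {H : ℝ} (hH : 0 < H) {t : ℝ≥0} (ht : 0 < t) :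
    expTime H (Real.log ((t : ℝ) ^ (-H))) = t := by
  apply NNReal.coe_injective
  rw [coe_expTime, log_rpow_neg ht]
  rw [show -(-H * Real.log t) / H = Real.log t by field_simp]
  exact Real.exp_log (NNReal.coe_pos.2 ht)

/-- The right-continuous version of a càdlàg path run backwards through the time change. -/
noncomputable def backPath (H : ℝ) (x : ℝ≥0 → ℝ) : ℝ → ℝ :=
  Function.rightLim fun s ↦ x (expTime H s)

section BackPath

variable {H : ℝ} {x : ℝ≥0 → ℝ}

/-- The time change is decreasing, so right-continuity becomes left-continuity. Hence `backPath`
takes right limits, and the left limits of `backPath` recover `x`. -/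
theorem IsCadlag.continuousWithinAt_comp_expTime (hH : 0 < H) (hx : IsCadlag x) (s : ℝ) :
    ContinuousWithinAt (fun s ↦ x (expTime H s)) (Set.Iic s) s :=
  (hx (expTime H s)).1.comp (continuous_expTime H).continuousWithinAt
    fun _ hr ↦ (strictAnti_expTime hH).antitone hr

theorem IsCadlag.tendsto_comp_expTime_nhdsGT (hH : 0 < H) (hx : IsCadlag x) (s : ℝ) :
    Tendsto (fun s ↦ x (expTime H s)) (𝓝[>] s) (𝓝 (backPath H x s)) := by
  obtain ⟨l, hl⟩ := (hx (expTime H s)).2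
  refine tendsto_rightLim_of_tendsto ⟨l, hl.comp ?_⟩
  refine tendsto_nhdsWithin_iff.2
    ⟨((continuous_expTime H).tendsto s).mono_left nhdsWithin_le_nhds, ?_⟩
  filter_upwards [self_mem_nhdsWithin] with r hr using strictAnti_expTime hH hr

theorem IsCadlag.tendsto_backPath_nhdsLT (hH : 0 < H) (hx : IsCadlag x) (s : ℝ) :
    Tendsto (backPath H x) (𝓝[<] s) (𝓝 (x (expTime H s))) :=
  tendsto_rightLim_nhdsLT ((hx.continuousWithinAt_comp_expTime hH s).tendsto.mono_left
    (nhdsWithin_mono _ Set.Iio_subset_Iic_self))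

theorem IsCadlag.backPath (hH : 0 < H) (hx : IsCadlag x) : IsCadlag (backPath H x) :=
  fun s ↦ ⟨continuousWithinAt_rightLim_Ici (hx.tendsto_comp_expTime_nhdsGT hH s),
    _, hx.tendsto_backPath_nhdsLT hH s⟩

theorem IsCadlag.leftLim_backPath (hH : 0 < H) (hx : IsCadlag x) (s : ℝ) :
    Function.leftLim (_root_.backPath H x) s = x (expTime H s) :=
  leftLim_eq_of_tendsto (hx.tendsto_backPath_nhdsLT hH s)

theorem IsCadlag.tendsto_backPath_atTop (hH : 0 < H) (hx : IsCadlag x) :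
    Tendsto (_root_.backPath H x) atTop (𝓝 (x 0)) := by
  refine tendsto_rightLim_atTop_of_tendsto ?_
  have h0 := (hx 0).1
  rw [show Set.Ici (0 : ℝ≥0) = Set.univ from Set.eq_univ_of_forall fun _ ↦ Set.mem_Ici.2 zero_le,
    continuousWithinAt_univ] at h0
  exact h0.tendsto.comp (tendsto_expTime_atTop hH)

theorem IsCadlag.exists_bound_backPath (hH : 0 < H) (hx : IsCadlag x) :
    ∃ C, ∀ s, 0 ≤ s → |_root_.backPath H x s| ≤ C := by
  obtain ⟨N, hN⟩ := eventually_atTop.1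
    ((hx.tendsto_backPath_atTop hH).abs.eventually_le_const (lt_add_one _))
  obtain ⟨C, hC⟩ := (hx.backPath hH).exists_bound 0 N
  refine ⟨max C (|x 0| + 1), fun s hs ↦ ?_⟩
  rcases le_total s N with h | h
  · exact (hC s ⟨hs, h⟩).trans (le_max_left _ _)
  · exact (hN s h).trans (le_max_right _ _)

end BackPath

/-! ### From Sato processes to Lévy processes -/

section Converse

variable {Ω : Type*} [MeasurableSpace Ω] {P : Measure Ω} {H : ℝ}
  {X : ℝ≥0 → Ω → ℝ}

/-- The process `Y_s = -∫_{(0, s]} e^r dX_{e^{-r/H}}`. -/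
noncomputable def backLevy (H : ℝ) (X : ℝ≥0 → Ω → ℝ) (s : ℝ) (ω : Ω) : ℝ :=
  -stInt Real.exp (backPath H fun t ↦ X t ω) 0 s

/-- There are no fixed jumps: along `s + 1/(n+1)` the process converges in probability to its value
and pathwise to the right limit. -/
theorem IsAdditiveProcess.backPath_ae_eq [IsProbabilityMeasure P] (hH : 0 < H)
    (hX : IsAdditiveProcess X P) (s : ℝ) :
    X (expTime H s) =ᵐ[P] fun ω ↦ backPath H (fun t ↦ X t ω) s := by
  have hlim : Tendsto (fun n : ℕ ↦ s + 1 / ((n : ℝ) + 1)) atTop (𝓝[>] s) := by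
    refine tendsto_nhdsWithin_iff.2 ⟨?_, .of_forall fun n ↦ ?_⟩
    · simpa using tendsto_one_div_add_atTop_nhds_zero_nat (𝕜 := ℝ).const_add s
    · have : (0 : ℝ) < 1 / ((n : ℝ) + 1) := by positivity
      exact lt_add_of_pos_right s this
  have h1 : TendstoInMeasure P (fun n : ℕ ↦ X (expTime H (s + 1 / ((n : ℝ) + 1)))) atTop
      (X (expTime H s)) :=
    (hX.stochContinuous (expTime H s)).comp
      (((continuous_expTime H).tendsto s).comp (hlim.mono_right nhdsWithin_le_nhds))
  have h2 : TendstoInMeasure P (fun n : ℕ ↦ X (expTime H (s + 1 / ((n : ℝ) + 1)))) atTop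
      fun ω ↦ backPath H (fun t ↦ X t ω) s := by
    refine tendstoInMeasure_of_tendsto_ae
      (fun n ↦ (hX.aemeasurable _).aestronglyMeasurable) ?_
    filter_upwards [hX.cadlag] with ω hω
    exact (hω.tendsto_comp_expTime_nhdsGT hH s).comp hlim
  exact tendstoInMeasure_ae_unique h1 h2

theorem IsAdditiveProcess.ae_cadlag_backPath (hH : 0 < H) (hX : IsAdditiveProcess X P) :
    ∀ᵐ ω ∂P, IsCadlag (fun s ↦ backPath H (fun t ↦ X t ω) s) :=
  hX.cadlag.mono fun _ hω ↦ hω.backPath hH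

theorem IsAdditiveProcess.backLevy_sub (hH : 0 < H) (hX : IsAdditiveProcess X P) :
    ∀ᵐ ω ∂P, ∀ s t, backLevy H X t ω - backLevy H X s ω =
      -stInt Real.exp (backPath H fun t ↦ X t ω) s t := by
  filter_upwards [hX.cadlag] with ω hω s t
  have := stInt_add Real.contDiff_exp (hω.backPath hH) 0 s t
  unfold backLevy
  linarith

/-- Self-similarity with `c = e^{-h/H}`, for which `c^H = e^{-h}`. This scaling is the source of
stationarity. -/
theorem IsSatoProcess.identDistrib_backPath [IsProbabilityMeasure P] (hH : 0 < H)
    (hX : IsSatoProcess H X P) (h : ℝ) (I : Finset ℝ) :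
    IdentDistrib (fun ω (r : I) ↦ Real.exp h * backPath H (fun t ↦ X t ω) (r + h))
      (fun ω (r : I) ↦ backPath H (fun t ↦ X t ω) r) P P := by
  classical
  let J : Finset ℝ≥0 := I.image (expTime H)
  let φ : I → J := fun r ↦ ⟨expTime H r, Finset.mem_image_of_mem _ r.2⟩
  have h1 := hX.selfSimilar (expTime H h) (expTime_pos H h) J
  have hu : Measurable fun (v : J → ℝ) (r : I) ↦ Real.exp h * v (φ r) :=
    measurable_pi_lambda _ fun r ↦ (measurable_pi_apply (φ r)).const_mul _
  have h2 := h1.comp hu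
  have hae := ae_all_iff.2 fun r : I ↦ hX.additive.backPath_ae_eq hH (r : ℝ)
  have hae' := ae_all_iff.2 fun r : I ↦ hX.additive.backPath_ae_eq hH ((r : ℝ) + h)
  refine ((IdentDistrib.of_ae_eq h2.aemeasurable_fst ?_).symm.trans h2).trans
    (IdentDistrib.of_ae_eq h2.aemeasurable_snd ?_)
  · filter_upwards [hae'] with ω hω
    funext r
    simp only [Function.comp, φ, ← hω r, expTime_add]
  · filter_upwards [hae] with ω hω
    funext r
    simp only [Function.comp, φ, ← hω r, expTime_rpow hH]
    rw [← mul_assoc, ← Real.exp_add]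
    simp

theorem IsSatoProcess.isDoubleSidedLevy_backLevy [IsProbabilityMeasure P] (hH : 0 < H)
    (hX : IsSatoProcess H X P) :
    IsDoubleSidedLevy (backLevy H X) P := by
  have hA := hX.additive
  set A : ℝ → Ω → ℝ := fun s ω ↦ backPath H (fun t ↦ X t ω) s with hAdef
  have hAc : ∀ᵐ ω ∂P, IsCadlag fun s ↦ A s ω := hA.ae_cadlag_backPath hH
  have hexp : ContDiff ℝ 1 Real.exp := Real.contDiff_exp
  have hAX : ∀ s, X (expTime H s) =ᵐ[P] A s := hA.backPath_ae_eq hH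
  obtain ⟨A', hA'm, hA'⟩ := exists_measurable_version
    fun s ↦ (hA.aemeasurable (expTime H s)).congr (hAX s)
  have hind : HasIndepIncrements A' P :=
    ((hA.indep.comp_antitone (strictAnti_expTime hH).antitone).congr hAX).congr hA'
  have hsm : ∀ {s t : ℝ}, s ≤ t → ∀ {S : Set ℝ}, Set.Icc s t ⊆ S →
      AEStronglyMeasurable[incrSigma A' S] (fun ω ↦ stInt Real.exp (fun r ↦ A r ω) s t) P :=
    fun hst _ hS ↦ aestronglyMeasurable_stInt hexp hA' hAc hst hS
  have hmeas : ∀ {s t : ℝ}, s ≤ t → AEMeasurable (fun ω ↦ stInt Real.exp (fun r ↦ A r ω) s t) P :=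
    fun hst ↦ ((hsm hst subset_rfl).mono (incrSigma_le hA'm _)).aemeasurable
  have hsub := hA.backLevy_sub hH
  refine ⟨fun s ↦ ?_, .of_forall fun ω ↦ ?_, fun n t ht ↦ ?_, fun s t h hst ↦ ?_, ?_⟩
  · rcases le_total 0 s with hs | hs
    · exact (hmeas hs).neg
    -- For `s ≤ 0` the process is the integral over `(s, 0]` with a plus sign.
    · refine (hmeas hs).congr ?_
      filter_upwards [hsub] with ω hω
      have := hω s 0
      have h0 : backLevy H X 0 ω = 0 := by simp [backLevy, stInt_self]
      rw [h0] at this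
      linarith
  · simp [backLevy, stInt_self]
  · have hV := hind.iIndepFun_of_incrSigma hA'm
      (S := fun i : Fin n ↦ Set.Icc (t i.castSucc) (t i.succ))
      (V := fun i ω ↦ -stInt Real.exp (fun r ↦ A r ω) (t i.castSucc) (t i.succ))
      (Or.inl fun i j hj x hx y hy ↦ hx.2.trans ((ht ?_).trans hy.1))
      (fun i ↦ (hsm (ht (Fin.castSucc_le_succ i)) subset_rfl).neg)
    · refine hV.congr fun i ↦ ?_
      filter_upwards [hsub] with ω hω
      exact (hω _ _).symm
    · exact Fin.succ_le_castSucc_iff.2 hj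
  · have hid := identDistrib_stInt (P := P) hexp (Y := fun r ω ↦ Real.exp h * A (r + h) ω) (Z := A)
      (hX.identDistrib_backPath hH h) (hAc.mono fun ω hω ↦ ?_) hAc (ι := Unit)
      (s := fun _ ↦ s) (t := fun _ ↦ t) (fun _ ↦ hst)
    · have hid' := hid.comp (u := fun v : Unit → ℝ ↦ -v ()) (measurable_pi_apply ()).neg
      refine ((IdentDistrib.of_ae_eq hid'.aemeasurable_fst ?_).symm.trans hid').trans
        (IdentDistrib.of_ae_eq hid'.aemeasurable_snd ?_)
      · filter_upwards [hsub] with ω hω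
        rw [hω]
        simp only [Function.comp]
        -- The factor `e^h` moves onto the weight, so that `e^h e^r = e^{r+h}` is the shifted
        -- exponential.
        rw [stInt_const_mul, ← stInt_const_mul_left]
        rw [← stInt_comp_add]
        simp only [Real.exp_add, mul_comm, hAdef]
      · filter_upwards [hsub] with ω hω
        rw [hω]
        rfl
    · exact (hω.comp_add_const h).const_mul _
  · filter_upwards [hAc] with ω hω
    exact (isCadlag_stInt hexp hω 0).neg

theorem HasExpIntegral.expIntegral_eq {g : ℝ → ℝ} {a x : ℝ} (h : HasExpIntegral g a x) :
    expIntegral g a = x := by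
  have hex : ∃ x, HasExpIntegral g a x := ⟨x, h⟩
  rw [expIntegral, dif_pos hex]
  exact tendsto_nhds_unique hex.choose_spec h

theorem IsAdditiveProcess.hasExpIntegral_backLevy (hH : 0 < H) (hX : IsAdditiveProcess X P) :
    ∀ᵐ ω ∂P, ∀ a, HasExpIntegral (fun s ↦ backLevy H X s ω) a (X (expTime H a) ω) := by
  filter_upwards [hX.cadlag, hX.zero] with ω hω h0 a
  unfold HasExpIntegral backLevy
  simp only [pathIntegral_exp_neg_stInt_exp (hω.backPath hH), hω.leftLim_backPath hH]
  have := (hω.tendsto_backPath_atTop hH).const_sub (X (expTime H a) ω)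
  simpa [h0] using this

theorem IsAdditiveProcess.satoIntegral_backLevy (hH : 0 < H) (hX : IsAdditiveProcess X P)
    (t : ℝ≥0) : X t =ᵐ[P] satoIntegral H (backLevy H X) t := by
  rcases eq_or_ne t 0 with rfl | ht
  · filter_upwards [hX.zero] with ω h0
    simp [satoIntegral, h0]
  · filter_upwards [hX.hasExpIntegral_backLevy hH] with ω hω
    rw [satoIntegral, if_neg ht, (hω _).expIntegral_eq, expTime_log_rpow_neg hH (pos_of_ne_zero ht)]

/-- Growth of order `e^s` keeps the `n`-th unit increment eventually below `e^{2n}`. Increments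
being independent, the exceedance probabilities are summable; by stationarity they equal `P(ln⁺|Y_1|
/ 2 > n)`. -/
theorem IsDoubleSidedLevy.integrable_posLog {Y : ℝ → Ω → ℝ} (hY : IsDoubleSidedLevy Y P)
    (hb : ∀ᵐ ω ∂P, ∃ C, ∀ s, 0 ≤ s → |Y s ω| ≤ C * Real.exp s) :
    Integrable (fun ω ↦ Real.posLog |Y 1 ω|) P := by
  have hd := hY.indep.nat (t := fun n : ℕ ↦ (n : ℝ)) Nat.mono_cast
  have hm : ∀ n : ℕ, AEMeasurable (fun ω ↦ Y ((n + 1 : ℕ) : ℝ) ω - Y (n : ℝ) ω) P :=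
    fun n ↦ (hY.aemeasurable _).sub (hY.aemeasurable _)
  have hBm : ∀ n : ℕ, MeasurableSet {x : ℝ | Real.exp (2 * n) < |x|} := fun n ↦
    measurableSet_lt measurable_const measurable_norm
  have hsum := hd.tsum_measure_ne_top hm (B := fun n ↦ {x | Real.exp (2 * n) < |x|}) hBm ?_
  · have hint : Integrable (fun ω ↦ Real.posLog |Y 1 ω| / 2) P := by
      refine integrable_of_tsum_measure_lt_top ?_ (fun ω ↦ ?_) ?_
      · exact (Real.continuous_posLog.measurable.comp_aemeasurable
          (hY.aemeasurable 1).norm).div_const 2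
      · exact div_nonneg Real.posLog_nonneg zero_le_two
      · convert hsum using 3 with n
        have h1 := hY.stationary 0 1 n zero_le_one
        have h2 := h1.measure_mem_eq (hBm n)
        rw [show (1 : ℝ) + n = ((n + 1 : ℕ) : ℝ) by push_cast; ring, zero_add] at h2
        rw [h2]
        refine measure_congr ?_
        filter_upwards [hY.zero] with ω h0
        simp only [eq_iff_iff]
        change (n : ℝ) < Real.posLog |Y 1 ω| / 2 ↔ Real.exp (2 * n) < |Y 1 ω - Y 0 ω|
        rw [h0, sub_zero, ← lt_posLog_abs_iff (by positivity), lt_div_iff₀ zero_lt_two, mul_comm]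
    simpa using hint.mul_const 2
  · filter_upwards [hb] with ω ⟨C, hC⟩
    have hC0 : 0 ≤ C := by
      have := hC 0 le_rfl
      rw [Real.exp_zero, mul_one] at this
      exact (abs_nonneg _).trans this
    have hlim : Tendsto (fun n : ℕ ↦ Real.exp (n : ℝ)) atTop atTop :=
      Real.tendsto_exp_atTop.comp tendsto_natCast_atTop_atTop
    filter_upwards [hlim.eventually_ge_atTop (C * Real.exp 1 + C)] with n hn
    simp only [not_lt]
    have h1 := hC ((n + 1 : ℕ) : ℝ) (by positivity)
    have h2 := hC (n : ℝ) (by positivity)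
    have h3 : Real.exp ((n + 1 : ℕ) : ℝ) = Real.exp n * Real.exp 1 := by
      rw [← Real.exp_add]; push_cast; rfl
    calc |Y ((n + 1 : ℕ) : ℝ) ω - Y (n : ℝ) ω|
        ≤ |Y ((n + 1 : ℕ) : ℝ) ω| + |Y (n : ℝ) ω| := abs_sub _ _
      _ ≤ C * (Real.exp n * Real.exp 1) + C * Real.exp n := by rw [h3] at h1; linarith
      _ = (C * Real.exp 1 + C) * Real.exp n := by ring
      _ ≤ Real.exp n * Real.exp n := by gcongr
      _ = Real.exp (2 * n) := by rw [← Real.exp_add]; ring_nf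

theorem IsSatoProcess.exists_levy [IsProbabilityMeasure P] (hH : 0 < H) (hX : IsSatoProcess H X P) :
    ∃ Y : ℝ → Ω → ℝ, IsDoubleSidedLevy Y P ∧
      Integrable (fun ω ↦ Real.posLog |Y 1 ω|) P ∧
      (∀ᵐ ω ∂P, ∀ a : ℝ, ∃ x, HasExpIntegral (fun s ↦ Y s ω) a x) ∧
      ∀ t : ℝ≥0, X t =ᵐ[P] satoIntegral H Y t := by
  have hL := hX.isDoubleSidedLevy_backLevy hH
  refine ⟨backLevy H X, hL, hL.integrable_posLog ?_, ?_, hX.additive.satoIntegral_backLevy hH⟩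
  · filter_upwards [hX.additive.cadlag] with ω hω
    obtain ⟨C, hC⟩ := hω.exists_bound_backPath hH
    refine ⟨2 * C, fun s hs ↦ ?_⟩
    rw [backLevy, abs_neg]
    exact abs_stInt_exp_le hC hs
  · filter_upwards [hX.additive.hasExpIntegral_backLevy hH] with ω hω a using ⟨_, hω a⟩

end Converse

/-! ### Ottaviani's maximal inequality and the growth of Lévy paths -/

section Ottaviani

variable {Ω : Type*} [MeasurableSpace Ω] {P : Measure Ω} [IsProbabilityMeasure P]

/-- Decompose by the first time `r` of exceeding `x + y` (the event `F r`). If the later increment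
is at most `y` (`G r`), the terminal value still exceeds `x`. These events are independent and `G r`
has probability at least `1/2`. -/
theorem ProbabilityTheory.HasIndepIncrements.measure_exists_finset_le {Y : ℝ → Ω → ℝ}
    (hY : HasIndepIncrements Y P) (hm : ∀ t, Measurable (Y t)) {a b x y : ℝ} {I : Finset ℝ}
    (hI : ∀ r ∈ I, r ∈ Set.Icc a b)
    (hy : ∀ r ∈ Set.Icc a b, 1 / 2 ≤ P {ω | |Y b ω - Y r ω| ≤ y}) :
    P {ω | ∃ r ∈ I, x + y < |Y r ω - Y a ω|} ≤ 2 * P {ω | x < |Y b ω - Y a ω|} := by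
  let F : ℝ → Set Ω := fun r ↦ {ω | x + y < |Y r ω - Y a ω|} ∩
    ⋂ q ∈ I.filter (· < r), {ω | |Y q ω - Y a ω| ≤ x + y}
  let G : ℝ → Set Ω := fun r ↦ {ω | |Y b ω - Y r ω| ≤ y}
  have hle := incrSigma_le hm
  have hF : ∀ r ∈ I, MeasurableSet[incrSigma Y (Set.Icc a r)] (F r) := by
    intro r hr
    have hmeas : ∀ q ∈ I, q ≤ r →
        Measurable[incrSigma Y (Set.Icc a r)] fun ω ↦ |Y q ω - Y a ω| := fun q hq hqr ↦
      measurable_norm.comp (measurable_incrSigma Y (S := Set.Icc a r)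
        ⟨le_rfl, (hI r hr).1⟩ ⟨(hI q hq).1, hqr⟩)
    refine MeasurableSet.inter (hmeas r hr le_rfl measurableSet_Ioi)
      (Finset.measurableSet_biInter _ fun q hq ↦ ?_)
    have hq' := Finset.mem_filter.1 hq
    exact hmeas q hq'.1 hq'.2.le measurableSet_Iic
  have hG : ∀ r ∈ I, MeasurableSet[incrSigma Y (Set.Icc r b)] (G r) := by
    intro r hr
    have hmeas : Measurable[incrSigma Y (Set.Icc r b)] fun ω ↦ |Y b ω - Y r ω| :=
      measurable_norm.comp (measurable_incrSigma Y (S := Set.Icc r b)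
        ⟨le_rfl, (hI r hr).2⟩ ⟨(hI r hr).2, le_rfl⟩)
    exact hmeas measurableSet_Iic
  have hind : ∀ r ∈ I, P (F r ∩ G r) = P (F r) * P (G r) := fun r hr ↦
    (Indep_iff _ _ _).1 (hY.indep_incrSigma hm fun u hu v hv ↦ hu.2.trans hv.1) _ _
      (hF r hr) (hG r hr)
  have hcover : {ω | ∃ r ∈ I, x + y < |Y r ω - Y a ω|} ⊆ ⋃ r ∈ I, F r := by
    rintro ω ⟨r, hr, hω⟩
    have hne : (I.filter fun r ↦ x + y < |Y r ω - Y a ω|).Nonempty :=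
      ⟨r, Finset.mem_filter.2 ⟨hr, hω⟩⟩
    obtain ⟨hm1, hm2⟩ := Finset.mem_filter.1 (Finset.min'_mem _ hne)
    refine Set.mem_biUnion hm1 ⟨hm2, Set.mem_iInter₂.2 fun q hq ↦ ?_⟩
    obtain ⟨hq1, hq2⟩ := Finset.mem_filter.1 hq
    by_contra hcon
    have hq3 : x + y < |Y q ω - Y a ω| := not_le.1 hcon
    exact (not_le.2 hq2) (Finset.min'_le _ q (Finset.mem_filter.2 ⟨hq1, hq3⟩))
  have hdisj : (I : Set ℝ).PairwiseDisjoint fun r ↦ F r ∩ G r := by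
    intro r hr q hq hne
    refine Set.disjoint_left.2 fun ω h1 h2 ↦ ?_
    rcases lt_or_gt_of_ne hne with h | h
    · have h3 : |Y r ω - Y a ω| ≤ x + y :=
        Set.mem_iInter₂.1 h2.1.2 r (Finset.mem_filter.2 ⟨hr, h⟩)
      exact (not_le.2 h1.1.1) h3
    · have h3 : |Y q ω - Y a ω| ≤ x + y :=
        Set.mem_iInter₂.1 h1.1.2 q (Finset.mem_filter.2 ⟨hq, h⟩)
      exact (not_le.2 h2.1.1) h3
  have hsub : (⋃ r ∈ I, F r ∩ G r) ⊆ {ω | x < |Y b ω - Y a ω|} := by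
    intro ω hω
    obtain ⟨r, hr, h1, h2⟩ := Set.mem_iUnion₂.1 hω
    have h3 : x + y < |Y r ω - Y a ω| := h1.1
    have h4 : |Y b ω - Y r ω| ≤ y := h2
    have h5 : |Y r ω - Y a ω| ≤ |Y b ω - Y a ω| + |Y b ω - Y r ω| := by
      calc |Y r ω - Y a ω| = |(Y b ω - Y a ω) - (Y b ω - Y r ω)| := by ring_nf
        _ ≤ _ := abs_sub _ _
    change x < |Y b ω - Y a ω|
    linarith
  calc P {ω | ∃ r ∈ I, x + y < |Y r ω - Y a ω|} ≤ P (⋃ r ∈ I, F r) := measure_mono hcover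
    _ ≤ ∑ r ∈ I, P (F r) := measure_biUnion_finset_le _ _
    _ ≤ ∑ r ∈ I, 2 * P (F r ∩ G r) := by
        refine Finset.sum_le_sum fun r hr ↦ ?_
        rw [hind r hr]
        calc P (F r) = 2 * (P (F r) * (1 / 2)) := by
              rw [mul_comm, mul_assoc, one_div, ENNReal.inv_mul_cancel two_ne_zero
                ENNReal.ofNat_ne_top, mul_one]
          _ ≤ 2 * (P (F r) * P (G r)) := by gcongr; exact hy r (hI r hr)
    _ = 2 * P (⋃ r ∈ I, F r ∩ G r) := by
        rw [measure_biUnion_finset hdisj fun r hr ↦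
          (hle _ _ (hF r hr)).inter (hle _ _ (hG r hr)), Finset.mul_sum]
    _ ≤ _ := by gcongr

/-- Continuity from below along the directed family of finite subsets of `D`. -/
theorem ProbabilityTheory.HasIndepIncrements.measure_exists_countable_le {Y : ℝ → Ω → ℝ}
    (hY : HasIndepIncrements Y P) (hm : ∀ t, AEMeasurable (Y t) P) {a b x y : ℝ} {D : Set ℝ}
    (hDc : D.Countable) (hD : D ⊆ Set.Icc a b)
    (hy : ∀ r ∈ Set.Icc a b, 1 / 2 ≤ P {ω | |Y b ω - Y r ω| ≤ y}) :
    P {ω | ∃ r ∈ D, x + y < |Y r ω - Y a ω|} ≤ 2 * P {ω | x < |Y b ω - Y a ω|} := by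
  obtain ⟨Y', hm', hYY'⟩ := exists_measurable_version hm
  have hY' : HasIndepIncrements Y' P := hY.congr hYY'
  have := hDc.to_subtype
  have hy' : ∀ r ∈ Set.Icc a b, 1 / 2 ≤ P {ω | |Y' b ω - Y' r ω| ≤ y} := by
    intro r hr
    refine (hy r hr).trans_eq (measure_congr ?_)
    filter_upwards [hYY' b, hYY' r] with ω h1 h2
    simp only [eq_iff_iff]
    change |Y b ω - Y r ω| ≤ y ↔ |Y' b ω - Y' r ω| ≤ y
    rw [h1, h2]
  have h1 : P {ω | ∃ r ∈ D, x + y < |Y r ω - Y a ω|} ≤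
      P (⋃ I : Finset D, {ω | ∃ r ∈ I.map (Function.Embedding.subtype _),
        x + y < |Y' r ω - Y' a ω|}) := by
    refine measure_mono_ae ?_
    filter_upwards [hYY' a, ae_all_iff.2 fun r : D ↦ hYY' r] with ω h1 h2
    rintro ⟨r, hr, hω⟩
    refine Set.mem_iUnion.2 ⟨{⟨r, hr⟩}, r, by simp, ?_⟩
    rwa [← h1, ← h2 ⟨r, hr⟩]
  refine h1.trans ?_
  rw [Directed.measure_iUnion]
  · refine iSup_le fun I ↦ (hY'.measure_exists_finset_le hm' ?_ hy').trans_eq ?_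
    · intro r hr
      simp only [Finset.mem_map, Function.Embedding.subtype_apply] at hr
      obtain ⟨q, _, rfl⟩ := hr
      exact hD q.2
    · congr 1
      refine measure_congr ?_
      filter_upwards [hYY' b, hYY' a] with ω h1 h2
      simp only [eq_iff_iff]
      change x < |Y' b ω - Y' a ω| ↔ x < |Y b ω - Y a ω|
      rw [h1, h2]
  · refine Monotone.directed_le fun I J hIJ ω hω ↦ ?_
    obtain ⟨r, hr, hω⟩ := hω
    exact ⟨r, Finset.map_subset_map.2 hIJ hr, hω⟩

end Ottaviani

section Growth

variable {Ω : Type*} [MeasurableSpace Ω] {P : Measure Ω} [IsProbabilityMeasure P] {Y : ℝ → Ω → ℝ}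

/-- Càdlàg paths are bounded on `[0, 1]`, which gives the bound there; stationarity makes it uniform
in `h`. The sets `B n` need not be measurable, but continuity from below holds for outer measure. -/
theorem IsDoubleSidedLevy.exists_half_le (hY : IsDoubleSidedLevy Y P) :
    ∃ y : ℝ, 0 ≤ y ∧ ∀ (h : ℝ), ∀ r ∈ Set.Icc h (h + 1),
      1 / 2 ≤ P {ω | |Y (h + 1) ω - Y r ω| ≤ y} := by
  let B : ℕ → Set Ω := fun n ↦ {ω | ∀ r ∈ Set.Icc (0 : ℝ) 1, |Y 1 ω - Y r ω| ≤ n}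
  have hBm : Monotone B := fun m n hmn ω hω r hr ↦ (hω r hr).trans (Nat.cast_le.2 hmn)
  have hB1 : P (⋃ n, B n) = 1 := by
    have hae : (⋃ n, B n) =ᵐ[P] Set.univ := by
      refine eventuallyEq_univ.2 ?_
      filter_upwards [hY.cadlag] with ω hω
      obtain ⟨C, hC⟩ := hω.exists_bound 0 1
      obtain ⟨n, hn⟩ := exists_nat_ge (2 * C)
      refine Set.mem_iUnion.2 ⟨n, fun r hr ↦ ?_⟩
      have h1 := hC r hr
      have h2 := hC 1 ⟨zero_le_one, le_rfl⟩
      have h3 := abs_sub (Y 1 ω) (Y r ω)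
      linarith
    rw [measure_congr hae, measure_univ]
  have hsup : ⨆ n, P (B n) = 1 := by rw [← Monotone.measure_iUnion hBm, hB1]
  obtain ⟨n, hn⟩ : ∃ n, 1 / 2 < P (B n) := by
    refine lt_iSup_iff.1 ?_
    rw [hsup, one_div]
    exact ENNReal.one_half_lt_one
  refine ⟨n, by positivity, fun h r hr ↦ ?_⟩
  have h1 := (hY.stationary (r - h) 1 h (by linarith [hr.2])).measure_mem_eq
    (s := {x | |x| ≤ n}) (measurableSet_le measurable_norm measurable_const)
  rw [show (1 : ℝ) + h = h + 1 by ring, sub_add_cancel] at h1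
  refine hn.le.trans (le_trans (measure_mono fun ω hω ↦ ?_) h1.ge)
  exact hω (r - h) ⟨by linarith [hr.1], by linarith [hr.2]⟩

theorem IsDoubleSidedLevy.tsum_measure_exp_lt (hY : IsDoubleSidedLevy Y P)
    (hlog : Integrable (fun ω ↦ Real.posLog |Y 1 ω|) P) :
    ∑' n : ℕ, P {ω | Real.exp (n / 2) < |Y (n + 1) ω - Y n ω|} ≠ ⊤ := by
  let _ : MeasureSpace Ω := ⟨P⟩
  have h := tsum_prob_mem_Ioi_lt_top (X := fun ω ↦ 2 * Real.posLog |Y 1 ω|) (hlog.const_mul 2)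
    fun ω ↦ mul_nonneg zero_le_two Real.posLog_nonneg
  refine ne_of_eq_of_ne (tsum_congr fun n ↦ ?_) h.ne
  have h1 := (hY.stationary 0 1 n zero_le_one).measure_mem_eq
    (s := {x | Real.exp (n / 2) < |x|}) (measurableSet_lt measurable_const measurable_norm)
  rw [show (1 : ℝ) + n = n + 1 by ring, zero_add] at h1
  refine h1.trans (measure_congr ?_)
  filter_upwards [hY.zero] with ω h0
  simp only [eq_iff_iff]
  change Real.exp (n / 2) < |Y 1 ω - Y 0 ω| ↔ (n : ℝ) < 2 * Real.posLog |Y 1 ω|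
  rw [h0, sub_zero, ← lt_posLog_abs_iff (by positivity), div_lt_iff₀ zero_lt_two, mul_comm]

/-- A right-continuous path that is bounded on rational points of `[a, b]`, `b` rational, is bounded
on `[a, b]`. -/
theorem IsCadlag.abs_sub_le_of_rat {g : ℝ → ℝ} (hg : IsCadlag g) {a c C : ℝ} {b : ℚ}
    (h : ∀ q : ℚ, (q : ℝ) ∈ Set.Icc a b → |g q - c| ≤ C) {r : ℝ} (hr : r ∈ Set.Icc a (b : ℝ)) :
    |g r - c| ≤ C := by
  rcases hr.2.eq_or_lt with rfl | hlt
  · exact h b hr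
  have hlim : Tendsto (fun s ↦ |g s - c|) (𝓝[>] r) (𝓝 |g r - c|) :=
    (((hg r).1.tendsto.mono_left (nhdsWithin_mono _ Set.Ioi_subset_Ici_self)).sub_const c).abs
  refine isClosed_Iic.mem_of_frequently_of_tendsto ?_ hlim
  refine frequently_iff.2 fun {U} hU ↦ ?_
  obtain ⟨u, hu, hus⟩ := (mem_nhdsGT_iff_exists_Ioo_subset).1 hU
  obtain ⟨q, hq1, hq2⟩ := exists_rat_btwn (lt_min hu hlt)
  exact ⟨q, hus ⟨hq1, hq2.trans_le (min_le_left _ _)⟩,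
    h q ⟨hr.1.trans hq1.le, hq2.le.trans (min_le_right _ _)⟩⟩

theorem IsCadlag.exists_exp_bound {g : ℝ → ℝ} (hg : IsCadlag g) {y : ℝ} (hy : 0 ≤ y)
    (h : ∀ᶠ n : ℕ in atTop, ∀ r ∈ Set.Icc (n : ℝ) (n + 1), |g r - g n| ≤ Real.exp (n / 2) + y) :
    ∃ C, ∀ s, 0 ≤ s → |g s| ≤ C * Real.exp (s / 2) := by
  obtain ⟨N, hN⟩ := eventually_atTop.1 h
  obtain ⟨B, hB⟩ := hg.exists_bound 0 (N + 1)
  have hB0 : 0 ≤ B := (abs_nonneg _).trans (hB 0 ⟨le_rfl, by positivity⟩)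
  -- `1 + y` serves the cells beyond `N`, as `e^{n/2} ≥ 1`; `2 * B` serves the others, which all lie
  -- in `[0, N + 1]`.
  set C : ℝ := 1 + y + 2 * B with hC
  have hone : ∀ s : ℝ, 0 ≤ s → 1 ≤ Real.exp (s / 2) := fun s hs ↦
    Real.one_le_exp (by positivity)
  have hstep : ∀ n : ℕ, ∀ r ∈ Set.Icc (n : ℝ) (n + 1), |g r - g n| ≤ C * Real.exp (n / 2) := by
    intro n r hr
    have h1 := hone n (by positivity)
    rcases le_total N n with hn | hn
    · have := hN n hn r hr
      nlinarith
    · have hnN : (n : ℝ) ≤ N := Nat.cast_le.2 hn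
      have hn0 : (0 : ℝ) ≤ n := by positivity
      have h2 := hB r ⟨by linarith [hr.1], by linarith [hr.2]⟩
      have h3 := hB n ⟨hn0, by linarith⟩
      have h4 := abs_sub (g r) (g n)
      nlinarith
  have hC0 : 0 ≤ C := by positivity
  -- Since `C ≤ K / 2` and `e^{1/2} ≥ 3/2`, a step adding `C e^{n/2}` preserves the bound `K
  -- e^{n/2}`.
  set K : ℝ := |g 0| + 2 * C with hK
  have hnat : ∀ n : ℕ, |g n| ≤ K * Real.exp (n / 2) := by
    intro n
    induction n with
    | zero =>
      simp only [Nat.cast_zero, zero_div, Real.exp_zero, mul_one, hK]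
      linarith
    | succ n ih =>
      have h1 := hstep n (n + 1) ⟨by linarith, le_rfl⟩
      have h2 : Real.exp (((n + 1 : ℕ) : ℝ) / 2) = Real.exp (n / 2) * Real.exp (1 / 2) := by
        rw [← Real.exp_add]; push_cast; ring_nf
      have h3 : (3 / 2 : ℝ) ≤ Real.exp (1 / 2) := by
        have := Real.add_one_le_exp (1 / 2 : ℝ)
        linarith
      have h4 := abs_sub_abs_le_abs_sub (g (n + 1)) (g n)
      have h5 : 2 * C ≤ K := by rw [hK]; linarith [abs_nonneg (g 0)]
      have hpos := Real.exp_pos ((n : ℝ) / 2)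
      rw [h2]
      push_cast
      calc |g (n + 1)| ≤ K * Real.exp (n / 2) + C * Real.exp (n / 2) := by linarith
        _ ≤ K * (Real.exp (n / 2) * (3 / 2)) := by nlinarith
        _ ≤ K * (Real.exp (n / 2) * Real.exp (1 / 2)) := by gcongr
  refine ⟨K + C, fun s hs ↦ ?_⟩
  have hfl := Nat.floor_le hs
  have hfl2 := (Nat.lt_floor_add_one s).le
  have h1 := hstep ⌊s⌋₊ s ⟨hfl, hfl2⟩
  have h2 := hnat ⌊s⌋₊
  have h4 := abs_sub_abs_le_abs_sub (g s) (g ⌊s⌋₊)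
  have h5 : 0 ≤ K := by positivity
  calc |g s| ≤ (K + C) * Real.exp ((⌊s⌋₊ : ℝ) / 2) := by linarith
    _ ≤ (K + C) * Real.exp (s / 2) := by gcongr

/-- Ottaviani controls the oscillation over rational times of `[n, n + 1]` by the unit increment,
Borel–Cantelli leaves finitely many bad `n`, and right-continuity covers the remaining times. The
rate `1/2` only has to be below `1`, to be beaten by `e^{-s}`. -/
theorem IsDoubleSidedLevy.ae_exists_exp_bound (hY : IsDoubleSidedLevy Y P)
    (hlog : Integrable (fun ω ↦ Real.posLog |Y 1 ω|) P) :
    ∀ᵐ ω ∂P, ∃ C, ∀ s, 0 ≤ s → |Y s ω| ≤ C * Real.exp (s / 2) := by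
  obtain ⟨y, hy0, hy⟩ := hY.exists_half_le
  let D : ℕ → Set ℝ := fun n ↦ Set.range ((↑) : ℚ → ℝ) ∩ Set.Icc (n : ℝ) (n + 1)
  have hE : ∀ n : ℕ, P {ω | ∃ r ∈ D n, Real.exp (n / 2) + y < |Y r ω - Y n ω|} ≤
      2 * P {ω | Real.exp (n / 2) < |Y (n + 1) ω - Y n ω|} := fun n ↦
    hY.indep.measure_exists_countable_le hY.aemeasurable
      ((Set.countable_range _).mono Set.inter_subset_left) Set.inter_subset_right (hy n)
  have hsum : ∑' n : ℕ, P {ω | ∃ r ∈ D n, Real.exp (n / 2) + y < |Y r ω - Y n ω|} ≠ ⊤ := by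
    refine ne_top_of_le_ne_top ?_ (ENNReal.tsum_le_tsum hE)
    rw [ENNReal.tsum_mul_left]
    exact ENNReal.mul_ne_top ENNReal.ofNat_ne_top (hY.tsum_measure_exp_lt hlog)
  filter_upwards [ae_eventually_notMem hsum, hY.cadlag] with ω hω hc
  refine hc.exists_exp_bound hy0 ?_
  filter_upwards [hω] with n hn r hr
  have hr' : r ∈ Set.Icc (n : ℝ) (((n + 1 : ℕ) : ℚ) : ℝ) := by
    push_cast
    exact hr
  refine hc.abs_sub_le_of_rat (fun q hq ↦ ?_) hr'
  by_contra hcon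
  refine hn ⟨q, ⟨⟨q, rfl⟩, ?_⟩, not_le.1 hcon⟩
  push_cast at hq
  exact hq

end Growth

/-! ### The improper integral along a path of moderate growth -/

/-- The value of `∫_{[a, ∞)} e^{-s} dg(s)` for a path `g` of moderate growth. -/
noncomputable def expTail (g : ℝ → ℝ) (a : ℝ) : ℝ :=
  -(Real.exp (-a) * g.leftLim a) + ∫ s in Set.Ioi a, Real.exp (-s) * g s

section PathTail

variable {g : ℝ → ℝ} {C : ℝ}

theorem IsCadlag.integrableOn_exp_neg_mul (hg : IsCadlag g)
    (hC : ∀ s, 0 ≤ s → |g s| ≤ C * Real.exp (s / 2)) (a : ℝ) :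
    IntegrableOn (fun s ↦ Real.exp (-s) * g s) (Set.Ioi a) := by
  have h1 : IntegrableOn (fun s ↦ Real.exp (-s) * g s) (Set.Ioi (max a 0)) := by
    have h2 : IntegrableOn (fun s : ℝ ↦ C * Real.exp (-(1 / 2) * s)) (Set.Ioi (max a 0)) :=
      (exp_neg_integrableOn_Ioi (max a 0) (by norm_num : (0 : ℝ) < 1 / 2)).const_mul C
    refine h2.mono' ((by fun_prop : Measurable fun s : ℝ ↦ Real.exp (-s)).mul
      hg.measurable).aestronglyMeasurable ?_
    refine (ae_restrict_iff' measurableSet_Ioi).2 (.of_forall fun s hs ↦ ?_)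
    have hs0 : 0 ≤ s := (le_max_right a 0).trans (Set.mem_Ioi.1 hs).le
    rw [norm_mul, Real.norm_eq_abs, Real.norm_eq_abs, Real.abs_exp]
    calc Real.exp (-s) * |g s| ≤ Real.exp (-s) * (C * Real.exp (s / 2)) := by
          gcongr
          exact hC s hs0
      _ = C * (Real.exp (-s) * Real.exp (s / 2)) := by ring
      _ = C * Real.exp (-(1 / 2) * s) := by rw [← Real.exp_add]; ring_nf
  have h2 : IntegrableOn (fun s ↦ Real.exp (-s) * g s) (Set.Ioc a (max a 0)) :=
    (intervalIntegrable_iff_integrableOn_Ioc_of_le (le_max_left a 0)).1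
      (hg.intervalIntegrable (by fun_prop) a (max a 0))
  rw [← Set.Ioc_union_Ioi_eq_Ioi (le_max_left a 0)]
  exact h2.union h1

theorem tendsto_exp_neg_mul (hC : ∀ s, 0 ≤ s → |g s| ≤ C * Real.exp (s / 2)) :
    Tendsto (fun s ↦ Real.exp (-s) * g s) atTop (𝓝 0) := by
  refine squeeze_zero_norm' (a := fun s ↦ C * Real.exp (-(s / 2))) ?_ ?_
  · filter_upwards [eventually_ge_atTop 0] with s hs
    rw [norm_mul, Real.norm_eq_abs, Real.norm_eq_abs, Real.abs_exp]
    calc Real.exp (-s) * |g s| ≤ Real.exp (-s) * (C * Real.exp (s / 2)) := by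
          gcongr
          exact hC s hs
      _ = C * (Real.exp (-s) * Real.exp (s / 2)) := by ring
      _ = C * Real.exp (-(s / 2)) := by rw [← Real.exp_add]; ring_nf
  · have h := (Real.tendsto_exp_neg_atTop_nhds_zero.comp
      (tendsto_id.atTop_div_const (zero_lt_two (α := ℝ)))).const_mul C
    simpa using h

theorem IsCadlag.hasExpIntegral (hg : IsCadlag g)
    (hC : ∀ s, 0 ≤ s → |g s| ≤ C * Real.exp (s / 2)) (a : ℝ) :
    HasExpIntegral g a (expTail g a) := by
  have h1 := intervalIntegral_tendsto_integral_Ioi a (hg.integrableOn_exp_neg_mul hC a) tendsto_id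
  have h2 := ((tendsto_exp_neg_mul hC).sub_const (Real.exp (-a) * g.leftLim a)).add h1
  rw [zero_sub] at h2
  refine h2.congr fun b ↦ ?_
  simp only [pathIntegral, deriv_exp_neg, neg_mul, intervalIntegral.integral_neg, id]
  ring

theorem IsCadlag.integral_Ioi_eq (hg : IsCadlag g)
    (hC : ∀ s, 0 ≤ s → |g s| ≤ C * Real.exp (s / 2)) (a : ℝ) :
    ∫ s in Set.Ioi a, Real.exp (-s) * g s =
      (∫ s in Set.Ioi (0 : ℝ), Real.exp (-s) * g s) - ∫ s in (0 : ℝ)..a, Real.exp (-s) * g s := by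
  rw [← intervalIntegral.integral_Ioi_sub_Ioi' (hg.integrableOn_exp_neg_mul hC 0)
    (hg.integrableOn_exp_neg_mul hC a)]
  ring

theorem IsCadlag.continuous_integral_Ioi (hg : IsCadlag g)
    (hC : ∀ s, 0 ≤ s → |g s| ≤ C * Real.exp (s / 2)) :
    Continuous fun a ↦ ∫ s in Set.Ioi a, Real.exp (-s) * g s := by
  rw [funext (hg.integral_Ioi_eq hC)]
  exact continuous_const.sub (intervalIntegral.continuous_primitive
    (fun a b ↦ hg.intervalIntegrable (by fun_prop) a b) 0)

theorem IsCadlag.tendsto_expTail_atTop (hg : IsCadlag g)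
    (hC : ∀ s, 0 ≤ s → |g s| ≤ C * Real.exp (s / 2)) : Tendsto (expTail g) atTop (𝓝 0) := by
  have h1 : Tendsto (fun a ↦ ∫ s in Set.Ioi a, Real.exp (-s) * g s) atTop (𝓝 0) := by
    rw [funext (hg.integral_Ioi_eq hC)]
    have := (intervalIntegral_tendsto_integral_Ioi 0 (hg.integrableOn_exp_neg_mul hC 0)
      tendsto_id).const_sub (∫ s in Set.Ioi (0 : ℝ), Real.exp (-s) * g s)
    simpa using this
  have h2 := tendsto_leftLim_atTop_of_tendsto (tendsto_exp_neg_mul hC)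
  have h3 : ∀ a, Function.leftLim (fun s ↦ Real.exp (-s) * g s) a = Real.exp (-a) * g.leftLim a :=
    fun a ↦ leftLim_eq_of_tendsto (((by fun_prop : Continuous fun s : ℝ ↦ Real.exp (-s)).tendsto
      a |>.mono_left nhdsWithin_le_nhds).mul (hg.tendsto_leftLim a))
  have h4 := h2.neg.add h1
  rw [neg_zero, add_zero] at h4
  exact h4.congr fun a ↦ by rw [h3, expTail]

/-- The integral term is continuous and `leftLim` is left-continuous. Under the decreasing time
change this becomes right-continuity of `satoPath`. -/
theorem IsCadlag.continuousWithinAt_expTail (hg : IsCadlag g)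
    (hC : ∀ s, 0 ≤ s → |g s| ≤ C * Real.exp (s / 2)) (a : ℝ) :
    ContinuousWithinAt (expTail g) (Set.Iic a) a :=
  (((by fun_prop : Continuous fun s : ℝ ↦ Real.exp (-s)).continuousWithinAt.mul
    (continuousWithinAt_leftLim_Iic (hg.tendsto_leftLim a))).neg).add
    (hg.continuous_integral_Ioi hC).continuousWithinAt

theorem IsCadlag.tendsto_expTail_nhdsGT (hg : IsCadlag g)
    (hC : ∀ s, 0 ≤ s → |g s| ≤ C * Real.exp (s / 2)) (a : ℝ) :
    Tendsto (expTail g) (𝓝[>] a)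
      (𝓝 (-(Real.exp (-a) * g a) + ∫ s in Set.Ioi a, Real.exp (-s) * g s)) :=
  ((((by fun_prop : Continuous fun s : ℝ ↦ Real.exp (-s)).tendsto a).mono_left
    nhdsWithin_le_nhds).mul (tendsto_leftLim_nhdsGT ((hg a).1.tendsto.mono_left
      (nhdsWithin_mono _ Set.Ioi_subset_Ici_self)))).neg.add
    (((hg.continuous_integral_Ioi hC).tendsto a).mono_left nhdsWithin_le_nhds)

theorem IsCadlag.continuousAt_expTail (hg : IsCadlag g)
    (hC : ∀ s, 0 ≤ s → |g s| ≤ C * Real.exp (s / 2)) {a : ℝ} (ha : g.leftLim a = g a) :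
    ContinuousAt (expTail g) a := by
  rw [continuousAt_iff_continuous_left'_right']
  refine ⟨(hg.continuousWithinAt_expTail hC a).mono Set.Iio_subset_Iic_self, ?_⟩
  have := hg.tendsto_expTail_nhdsGT hC a
  rwa [← ha] at this

/-! ### The path of the integral process -/

/-- The path `t ↦ ∫_{[ln (t^{-H}), ∞)} e^{-s} dg(s)`. -/
noncomputable def satoPath (H : ℝ) (g : ℝ → ℝ) (t : ℝ≥0) : ℝ :=
  if t = 0 then 0 else expTail g (Real.log ((t : ℝ) ^ (-H)))

theorem continuousAt_log_rpow_neg {t : ℝ≥0} (ht : 0 < t) (H : ℝ) :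
    ContinuousAt (fun t : ℝ≥0 ↦ Real.log ((t : ℝ) ^ (-H))) t := by
  have ht' : (0 : ℝ) < t := NNReal.coe_pos.2 ht
  exact (NNReal.continuous_coe.continuousAt.rpow_const (Or.inl ht'.ne')).log
    (Real.rpow_pos_of_pos ht' _).ne'

theorem log_rpow_neg_lt {H : ℝ} (hH : 0 < H) {s t : ℝ≥0} (hs : 0 < s) (hst : s < t) :
    Real.log ((t : ℝ) ^ (-H)) < Real.log ((s : ℝ) ^ (-H)) := by
  rw [log_rpow_neg hs, log_rpow_neg (hs.trans hst)]
  have := Real.log_lt_log (NNReal.coe_pos.2 hs) (NNReal.coe_lt_coe.2 hst)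
  nlinarith

theorem log_rpow_neg_le {H : ℝ} (hH : 0 < H) {s t : ℝ≥0} (hs : 0 < s) (hst : s ≤ t) :
    Real.log ((t : ℝ) ^ (-H)) ≤ Real.log ((s : ℝ) ^ (-H)) := by
  rcases hst.eq_or_lt with rfl | h
  · exact le_rfl
  · exact (log_rpow_neg_lt hH hs h).le

theorem tendsto_log_rpow_neg_zero {H : ℝ} (hH : 0 < H) :
    Tendsto (fun t : ℝ≥0 ↦ Real.log ((t : ℝ) ^ (-H))) (𝓝[≠] 0) atTop := by
  have h1 : Tendsto (fun t : ℝ≥0 ↦ (t : ℝ)) (𝓝[≠] 0) (𝓝[>] 0) := by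
    refine tendsto_nhdsWithin_iff.2
      ⟨(NNReal.continuous_coe.tendsto 0).mono_left nhdsWithin_le_nhds, ?_⟩
    filter_upwards [self_mem_nhdsWithin] with t ht using NNReal.coe_pos.2 (pos_of_ne_zero ht)
  have h2 := (Real.tendsto_log_nhdsGT_zero.comp h1).const_mul_atBot_of_neg (neg_lt_zero.2 hH)
  refine h2.congr' ?_
  filter_upwards [self_mem_nhdsWithin] with t ht
  exact (log_rpow_neg (pos_of_ne_zero ht) H).symm

theorem satoPath_eventuallyEq (H : ℝ) (g : ℝ → ℝ) {t : ℝ≥0} (ht : 0 < t) :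
    satoPath H g =ᶠ[𝓝 t] fun t ↦ expTail g (Real.log ((t : ℝ) ^ (-H))) := by
  filter_upwards [lt_mem_nhds ht] with s hs
  rw [satoPath, if_neg hs.ne']

theorem IsCadlag.continuousAt_satoPath_zero {H : ℝ} (hH : 0 < H) (hg : IsCadlag g)
    (hC : ∀ s, 0 ≤ s → |g s| ≤ C * Real.exp (s / 2)) : ContinuousAt (satoPath H g) 0 := by
  rw [continuousAt_iff_punctured_nhds, show satoPath H g 0 = 0 from if_pos rfl]
  refine ((hg.tendsto_expTail_atTop hC).comp (tendsto_log_rpow_neg_zero hH)).congr' ?_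
  filter_upwards [self_mem_nhdsWithin] with t ht
  exact (if_neg ht).symm

theorem IsCadlag.continuousAt_satoPath {H : ℝ} (hg : IsCadlag g)
    (hC : ∀ s, 0 ≤ s → |g s| ≤ C * Real.exp (s / 2)) {t : ℝ≥0} (ht : 0 < t)
    (hj : g.leftLim (Real.log ((t : ℝ) ^ (-H))) = g (Real.log ((t : ℝ) ^ (-H)))) :
    ContinuousAt (satoPath H g) t := by
  refine ContinuousAt.congr ?_ (satoPath_eventuallyEq H g ht).symm
  exact ContinuousAt.comp (f := fun t : ℝ≥0 ↦ Real.log ((t : ℝ) ^ (-H)))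
    (hg.continuousAt_expTail hC hj) (continuousAt_log_rpow_neg ht H)

theorem IsCadlag.satoPath {H : ℝ} (hH : 0 < H) (hg : IsCadlag g)
    (hC : ∀ s, 0 ≤ s → |g s| ≤ C * Real.exp (s / 2)) : IsCadlag (satoPath H g) := by
  intro t
  rcases eq_or_ne t 0 with rfl | ht0
  · refine ⟨(hg.continuousAt_satoPath_zero hH hC).continuousWithinAt, 0, ?_⟩
    rw [show Set.Iio (0 : ℝ≥0) = ∅ by ext; simp, nhdsWithin_empty]
    exact tendsto_bot
  have ht : 0 < t := pos_of_ne_zero ht0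
  have hev := satoPath_eventuallyEq H g ht
  have hc := continuousAt_log_rpow_neg ht H
  constructor
  · refine ContinuousWithinAt.congr_of_eventuallyEq ?_ (hev.filter_mono nhdsWithin_le_nhds)
      hev.self_of_nhds
    exact ContinuousWithinAt.comp (f := fun t : ℝ≥0 ↦ Real.log ((t : ℝ) ^ (-H)))
      (hg.continuousWithinAt_expTail hC _) hc.continuousWithinAt
      fun s hs ↦ log_rpow_neg_le hH ht hs
  · refine ⟨_, ((hg.tendsto_expTail_nhdsGT hC (Real.log ((t : ℝ) ^ (-H)))).comp
      (f := fun t : ℝ≥0 ↦ Real.log ((t : ℝ) ^ (-H)))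
      (tendsto_nhdsWithin_iff.2 ⟨hc.tendsto.mono_left nhdsWithin_le_nhds, ?_⟩)).congr'
      (hev.symm.filter_mono nhdsWithin_le_nhds)⟩
    filter_upwards [self_mem_nhdsWithin, nhdsWithin_le_nhds (lt_mem_nhds ht)] with s hs hs0
    exact log_rpow_neg_lt hH hs0 hs

end PathTail

/-! ### Self-similar additive processes have selfdecomposable marginals -/

/-- Take `c = b^{-1/H}`: then `X_c` has the law of `b⁻¹ X_1`, and `X_1 - X_c` is the independent
remainder. -/
theorem IsAdditiveProcess.isSelfdecomposable {Ω : Type*} [MeasurableSpace Ω] {P : Measure Ω}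
    [IsProbabilityMeasure P] {H : ℝ} (hH : 0 < H) {X : ℝ≥0 → Ω → ℝ} (hX : IsAdditiveProcess X P)
    (hs : IsSelfSimilar H X P) : IsSelfdecomposable (P.map (X 1)) := by
  intro b hb
  have hb0 : 0 < b := zero_lt_one.trans hb
  set c : ℝ≥0 := expTime H (Real.log b) with hc
  have hcH : (c : ℝ) ^ H = b⁻¹ := by
    rw [hc, expTime_rpow hH, Real.exp_neg, Real.exp_log hb0]
  have hc1 : c ≤ 1 := by
    have h0 : expTime H 0 = 1 := by apply NNReal.coe_injective; simp [coe_expTime]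
    rw [← h0]
    exact (strictAnti_expTime hH).antitone (Real.log_nonneg hb.le)
  have hid := (hs c (expTime_pos H _) {1}).comp
    (u := fun v : ({1} : Finset ℝ≥0) → ℝ ↦ v ⟨1, by simp⟩) (measurable_pi_apply _)
  have hmap : P.map (X c) = (P.map (X 1)).map fun x ↦ b⁻¹ * x := by
    have h1 := hid.map_eq
    simp only [Function.comp_def, mul_one, hcH] at h1
    rw [AEMeasurable.map_map_of_aemeasurable (by fun_prop) (hX.aemeasurable 1)]
    exact h1
  have hind := hX.indep.indepFun_eval_sub (zero_le (a := c)) hc1 hX.zero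
  have hm : AEMeasurable (X 1 - X c) P := (hX.aemeasurable 1).sub (hX.aemeasurable c)
  refine ⟨P.map (X 1 - X c), Measure.isProbabilityMeasure_map hm, ?_⟩
  rw [← hmap, ← hind.map_add_eq_map_conv_map₀ (hX.aemeasurable c) hm]
  congr 1
  funext ω
  simp

/-! ### From Lévy processes to Sato processes -/

section Direct

variable {Ω : Type*} [MeasurableSpace Ω] {P : Measure Ω} [IsProbabilityMeasure P] {H : ℝ}
  {Y : ℝ → Ω → ℝ}

/-- A Lévy process has no fixed discontinuities. -/
theorem IsDoubleSidedLevy.leftLim_ae_eq (hY : IsDoubleSidedLevy Y P) (a : ℝ) :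
    ∀ᵐ ω ∂P, Function.leftLim (fun s ↦ Y s ω) a = Y a ω := by
  have hlim : Tendsto (fun n : ℕ ↦ 1 / ((n : ℝ) + 1)) atTop (𝓝 0) :=
    tendsto_one_div_add_atTop_nhds_zero_nat
  have hpos : ∀ n : ℕ, (0 : ℝ) < 1 / ((n : ℝ) + 1) := fun n ↦ by positivity
  have hid : IdentDistrib (fun ω ↦ Y a ω - Function.leftLim (fun s ↦ Y s ω) a)
      (fun _ ↦ (0 : ℝ)) P P := by
    -- By stationarity the increment just before `a` has the law of the one just after `0`. The
    -- former tends to the jump at `a`, the latter to zero by right-continuity.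
    refine IdentDistrib.of_tendsto_ae
      (U := fun (n : ℕ) ω ↦ Y a ω - Y (a - 1 / ((n : ℝ) + 1)) ω)
      (U' := fun (n : ℕ) ω ↦ Y (1 / ((n : ℝ) + 1)) ω - Y 0 ω) (fun n ↦ ?_) ?_ ?_
    · have := hY.stationary 0 (1 / ((n : ℝ) + 1)) (a - 1 / ((n : ℝ) + 1)) (hpos n).le
      simpa using this
    · filter_upwards [hY.cadlag] with ω hω
      refine ((hω.tendsto_leftLim a).comp (tendsto_nhdsWithin_iff.2 ⟨?_, ?_⟩)).const_sub _
      · simpa using hlim.const_sub a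
      · exact .of_forall fun n ↦ sub_lt_self a (hpos n)
    · filter_upwards [hY.cadlag] with ω hω
      have h0 := ((hω 0).1.tendsto.comp
        (tendsto_nhdsWithin_iff.2 ⟨hlim, .of_forall fun n ↦ (hpos n).le⟩)).sub_const (Y 0 ω)
      simpa using h0
  have h1 := hid.symm.ae_snd (p := fun x ↦ x = 0) (measurableSet_singleton 0)
    (.of_forall fun _ ↦ rfl)
  filter_upwards [h1] with ω hω
  linarith

theorem IsDoubleSidedLevy.ae_satoIntegral (hY : IsDoubleSidedLevy Y P)
    (hlog : Integrable (fun ω ↦ Real.posLog |Y 1 ω|) P) (H : ℝ) :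
    ∀ᵐ ω ∂P, ∀ t, satoIntegral H Y t ω = satoPath H (fun s ↦ Y s ω) t := by
  filter_upwards [hY.cadlag, hY.ae_exists_exp_bound hlog] with ω hω ⟨C, hC⟩ t
  unfold satoIntegral satoPath
  split_ifs
  · rfl
  · exact (hω.hasExpIntegral hC _).expIntegral_eq

/-- At a fixed time the jump at the lower limit vanishes almost surely, so the half-open integrals,
which depend on increments only, may be used instead. -/
theorem IsDoubleSidedLevy.tendsto_stInt_satoIntegral (hY : IsDoubleSidedLevy Y P)
    (hlog : Integrable (fun ω ↦ Real.posLog |Y 1 ω|) P) (H : ℝ) {t : ℝ≥0} (ht : 0 < t) :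
    ∀ᵐ ω ∂P, Tendsto (fun b ↦ stInt (fun s ↦ Real.exp (-s)) (fun s ↦ Y s ω)
      (Real.log ((t : ℝ) ^ (-H))) b) atTop (𝓝 (satoIntegral H Y t ω)) := by
  filter_upwards [hY.cadlag, hY.ae_exists_exp_bound hlog,
    hY.leftLim_ae_eq (Real.log ((t : ℝ) ^ (-H)))] with ω hω ⟨C, hC⟩ hj
  have h := hω.hasExpIntegral hC (Real.log ((t : ℝ) ^ (-H)))
  rw [satoIntegral, if_neg ht.ne', h.expIntegral_eq]
  refine h.congr fun b ↦ ?_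
  rw [pathIntegral_eq_stInt, hj, sub_self, mul_zero, add_zero]

theorem IsDoubleSidedLevy.satoIntegral_sub (hY : IsDoubleSidedLevy Y P)
    (hlog : Integrable (fun ω ↦ Real.posLog |Y 1 ω|) P) (H : ℝ) {s t : ℝ≥0} (hs : 0 < s)
    (ht : 0 < t) :
    ∀ᵐ ω ∂P, stInt (fun s ↦ Real.exp (-s)) (fun s ↦ Y s ω)
      (Real.log ((t : ℝ) ^ (-H))) (Real.log ((s : ℝ) ^ (-H))) =
      satoIntegral H Y t ω - satoIntegral H Y s ω := by
  filter_upwards [hY.cadlag, hY.tendsto_stInt_satoIntegral hlog H ht,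
    hY.tendsto_stInt_satoIntegral hlog H hs] with ω hω h1 h2
  refine tendsto_nhds_unique (tendsto_const_nhds (f := (atTop : Filter ℝ))) ((h1.sub h2).congr
    fun b ↦ ?_)
  have := stInt_add contDiff_exp_neg hω (Real.log ((t : ℝ) ^ (-H))) (Real.log ((s : ℝ) ^ (-H))) b
  linarith

theorem IsDoubleSidedLevy.aestronglyMeasurable_satoIntegral (hY : IsDoubleSidedLevy Y P)
    (hlog : Integrable (fun ω ↦ Real.posLog |Y 1 ω|) P) (H : ℝ) {Y' : ℝ → Ω → ℝ}
    (hYY' : ∀ s, Y s =ᵐ[P] Y' s) {t : ℝ≥0} (ht : 0 < t) {S : Set ℝ}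
    (hS : Set.Ici (Real.log ((t : ℝ) ^ (-H))) ⊆ S) :
    AEStronglyMeasurable[incrSigma Y' S] (satoIntegral H Y t) P := by
  have hb : Tendsto (fun n : ℕ ↦ Real.log ((t : ℝ) ^ (-H)) + n) atTop atTop :=
    tendsto_atTop_add_const_left _ _ tendsto_natCast_atTop_atTop
  refine aestronglyMeasurable_of_tendsto_ae' (fun n ↦ ?_)
    ((hY.tendsto_stInt_satoIntegral hlog H ht).mono fun ω hω ↦ hω.comp hb)
  exact aestronglyMeasurable_stInt contDiff_exp_neg hYY' hY.cadlag
    (le_add_of_nonneg_right n.cast_nonneg) (Set.Icc_subset_Ici_self.trans hS)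

theorem IsDoubleSidedLevy.hasIndepIncrements_satoIntegral (hH : 0 < H)
    (hY : IsDoubleSidedLevy Y P) (hlog : Integrable (fun ω ↦ Real.posLog |Y 1 ω|) P) :
    HasIndepIncrements (satoIntegral H Y) P := by
  obtain ⟨Y', hm', hYY'⟩ := exists_measurable_version hY.aemeasurable
  intro n t ht
  refine (hY.indep.congr hYY').iIndepFun_of_incrSigma hm'
    -- Describing the logarithmic times through `expTime` also covers the endpoint `0`, where the
    -- interval is unbounded above.
    (S := fun i : Fin n ↦ {r | expTime H r ∈ Set.Icc (t i.castSucc) (t i.succ)})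
    (Or.inr fun i j hj x hx y hy ↦ ?_) (fun i ↦ ?_)
  · refine (strictAnti_expTime hH).le_iff_ge.1 (hx.2.trans ((ht ?_).trans hy.1))
    exact Fin.succ_le_castSucc_iff.2 hj
  · have hle : t i.castSucc ≤ t i.succ := ht (Fin.castSucc_le_succ i)
    generalize t i.castSucc = u at *
    generalize t i.succ = v at *
    have hanti := (strictAnti_expTime hH).antitone
    rcases eq_or_ne v 0 with rfl | hv
    · obtain rfl : u = 0 := le_antisymm hle zero_le
      simp only [sub_self]
      exact aestronglyMeasurable_const
    have hv0 : 0 < v := pos_of_ne_zero hv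
    rcases eq_or_ne u 0 with rfl | hu
    · have h0 : ∀ ω, satoIntegral H Y 0 ω = 0 := fun ω ↦ if_pos rfl
      simp only [h0, sub_zero]
      refine hY.aestronglyMeasurable_satoIntegral hlog H hYY' hv0 fun r hr ↦ ⟨zero_le, ?_⟩
      exact (hanti hr).trans_eq (expTime_log_rpow_neg hH hv0)
    · have hu0 : 0 < u := pos_of_ne_zero hu
      refine AEStronglyMeasurable.congr ?_ (hY.satoIntegral_sub hlog H hu0 hv0)
      refine aestronglyMeasurable_stInt contDiff_exp_neg hYY' hY.cadlag
        (log_rpow_neg_le hH hu0 hle) fun r hr ↦ ⟨?_, ?_⟩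
      · exact (expTime_log_rpow_neg hH hu0).ge.trans (hanti hr.2)
      · exact (hanti hr.1).trans_eq (expTime_log_rpow_neg hH hv0)

theorem IsDoubleSidedLevy.isAdditiveProcess_satoIntegral (hH : 0 < H)
    (hY : IsDoubleSidedLevy Y P) (hlog : Integrable (fun ω ↦ Real.posLog |Y 1 ω|) P) :
    IsAdditiveProcess (satoIntegral H Y) P := by
  have hmeas : ∀ t, AEMeasurable (satoIntegral H Y t) P := by
    intro t
    rcases eq_or_ne t 0 with rfl | ht
    · have h0 : satoIntegral H Y 0 = fun _ ↦ 0 := funext fun ω ↦ if_pos rfl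
      rw [h0]
      exact aemeasurable_const
    · obtain ⟨Y', hm', hYY'⟩ := exists_measurable_version hY.aemeasurable
      exact ((hY.aestronglyMeasurable_satoIntegral hlog H hYY' (pos_of_ne_zero ht)
        subset_rfl).mono (incrSigma_le hm' _)).aemeasurable
  refine ⟨hmeas, .of_forall fun ω ↦ if_pos rfl, hY.hasIndepIncrements_satoIntegral hH hlog,
    fun t ↦ ?_, ?_⟩
  · have hcont : ∀ᵐ ω ∂P, ContinuousAt (fun t ↦ satoIntegral H Y t ω) t := by
      filter_upwards [hY.cadlag, hY.ae_exists_exp_bound hlog, hY.ae_satoIntegral hlog H,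
        hY.leftLim_ae_eq (Real.log ((t : ℝ) ^ (-H)))] with ω hω ⟨C, hC⟩ heq hj
      simp only [heq]
      rcases eq_or_ne t 0 with rfl | ht
      · exact hω.continuousAt_satoPath_zero hH hC
      · exact hω.continuousAt_satoPath hC (pos_of_ne_zero ht) hj
    intro ε hε
    -- Almost sure continuity at the fixed `t` gives convergence in measure along each sequence
    -- tending to `t`.
    refine tendsto_of_seq_tendsto fun u hu ↦ ?_
    exact tendstoInMeasure_of_tendsto_ae (fun n ↦ (hmeas (u n)).aestronglyMeasurable)
      (hcont.mono fun ω hω ↦ hω.tendsto.comp hu) ε hε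
  · filter_upwards [hY.cadlag, hY.ae_exists_exp_bound hlog, hY.ae_satoIntegral hlog H]
      with ω hω ⟨C, hC⟩ heq
    simp only [heq]
    exact hω.satoPath hH hC

theorem stInt_exp_neg_shift {g : ℝ → ℝ} (hg : IsCadlag g) (h s t : ℝ) :
    Real.exp (-h) * stInt (fun s ↦ Real.exp (-s)) (fun r ↦ g (r + h) - g h) s t =
      stInt (fun s ↦ Real.exp (-s)) g (s + h) (t + h) := by
  rw [stInt_sub_const contDiff_exp_neg (hg.comp_add_const h), ← stInt_const_mul_left,
    ← stInt_comp_add]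
  congr 1
  funext r
  rw [← Real.exp_add]
  ring_nf

/-- With `a t = ln (t^{-H})` one has `a (c t) = a t + a c` and `e^{-a c} = c^H`. Shifting the
integral by `a c` thus produces the factor `c^H` and the integrator `Y (· + a c) - Y (a c)`, which
has the law of `Y`. -/
theorem IsDoubleSidedLevy.isSelfSimilar_satoIntegral (hH : 0 < H)
    (hY : IsDoubleSidedLevy Y P) (hlog : Integrable (fun ω ↦ Real.posLog |Y 1 ω|) P) :
    IsSelfSimilar H (satoIntegral H Y) P := by
  intro c hc I
  set w : ℝ → ℝ := fun s ↦ Real.exp (-s) with hw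
  set a : ℝ≥0 → ℝ := fun t ↦ Real.log ((t : ℝ) ^ (-H)) with ha
  have hac : ∀ t, 0 < t → a (c * t) = a t + a c := by
    intro t ht
    simp only [ha]
    rw [log_rpow_neg (mul_pos hc ht), log_rpow_neg ht, log_rpow_neg hc, NNReal.coe_mul,
      Real.log_mul (NNReal.coe_pos.2 hc).ne' (NNReal.coe_pos.2 ht).ne']
    ring
  have hcH : Real.exp (-a c) = (c : ℝ) ^ H := by
    have h := expTime_rpow hH (a c)
    rw [show expTime H (a c) = c from expTime_log_rpow_neg hH hc] at h
    exact h.symm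
  have hb : ∀ r : ℝ, Tendsto (fun n : ℕ ↦ r + n) atTop atTop := fun r ↦
    tendsto_atTop_add_const_left _ _ tendsto_natCast_atTop_atTop
  have hlim : ∀ᵐ ω ∂P, ∀ t : I, (t : ℝ≥0) ≠ 0 → Tendsto (fun n : ℕ ↦ stInt w (fun s ↦ Y s ω)
      (a t) (a t + n)) atTop (𝓝 (satoIntegral H Y t ω)) := by
    refine ae_all_iff.2 fun t ↦ ?_
    rcases eq_or_ne (t : ℝ≥0) 0 with h0 | h0
    · exact .of_forall fun ω h ↦ absurd h0 h
    · exact (hY.tendsto_stInt_satoIntegral hlog H (pos_of_ne_zero h0)).mono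
        fun ω hω _ ↦ hω.comp (hb _)
  have hlim' : ∀ᵐ ω ∂P, ∀ t : I, (t : ℝ≥0) ≠ 0 → Tendsto (fun n : ℕ ↦ stInt w (fun s ↦ Y s ω)
      (a t + a c) (a t + n + a c)) atTop (𝓝 (satoIntegral H Y (c * t) ω)) := by
    refine ae_all_iff.2 fun t ↦ ?_
    rcases eq_or_ne (t : ℝ≥0) 0 with h0 | h0
    · exact .of_forall fun ω h ↦ absurd h0 h
    · have ht := pos_of_ne_zero h0
      refine (hY.tendsto_stInt_satoIntegral hlog H (mul_pos hc ht)).mono fun ω hω _ ↦ ?_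
      have h := hω.comp (hb (a (c * t)))
      change Tendsto (fun n : ℕ ↦ stInt w (fun s ↦ Y s ω) (a (c * t)) (a (c * t) + n)) _ _ at h
      rw [hac _ ht] at h
      refine h.congr fun n ↦ ?_
      rw [add_right_comm]
  -- At time `0` the logarithm takes a default value, so the truncated integral there is meaningless
  -- and is overwritten by `0`.
  have hu : Measurable fun (v : I → ℝ) (t : I) ↦
      if (t : ℝ≥0) = 0 then 0 else (c : ℝ) ^ H * v t := by
    refine measurable_pi_lambda _ fun t ↦ ?_
    split_ifs
    · exact measurable_const
    · exact (measurable_pi_apply t).const_mul _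
  have hid : ∀ n : ℕ, IdentDistrib
      (fun ω (t : I) ↦ if (t : ℝ≥0) = 0 then 0 else
        (c : ℝ) ^ H * stInt w (fun r ↦ Y (r + a c) ω - Y (a c) ω) (a t) (a t + n))
      (fun ω (t : I) ↦ if (t : ℝ≥0) = 0 then 0 else
        (c : ℝ) ^ H * stInt w (fun r ↦ Y r ω) (a t) (a t + n)) P P := fun n ↦
    (identDistrib_stInt contDiff_exp_neg (hY.identDistrib_shift (a c))
      (hY.cadlag.mono fun ω hω ↦ (hω.comp_add_const (a c)).sub_const _) hY.cadlag
      (s := fun t : I ↦ a t) (t := fun t : I ↦ a t + n)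
      (fun t ↦ le_add_of_nonneg_right n.cast_nonneg)).comp hu
  refine IdentDistrib.of_tendsto_ae hid ?_ ?_
  · filter_upwards [hlim', hY.cadlag] with ω hω hcad
    refine tendsto_pi_nhds.2 fun t ↦ ?_
    rcases eq_or_ne (t : ℝ≥0) 0 with h0 | h0
    · simp [h0, satoIntegral]
    · simp only [h0, if_false, ← hcH]
      refine (hω t h0).congr fun n ↦ ?_
      exact (stInt_exp_neg_shift hcad _ _ _).symm
  · filter_upwards [hlim] with ω hω
    refine tendsto_pi_nhds.2 fun t ↦ ?_
    rcases eq_or_ne (t : ℝ≥0) 0 with h0 | h0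
    · simp [h0, satoIntegral]
    · simp only [h0, if_false]
      exact (hω t h0).const_mul _

theorem IsDoubleSidedLevy.isSatoProcess_satoIntegral (hH : 0 < H)
    (hY : IsDoubleSidedLevy Y P) (hlog : Integrable (fun ω ↦ Real.posLog |Y 1 ω|) P) :
    IsSatoProcess H (satoIntegral H Y) P :=
  have hA := hY.isAdditiveProcess_satoIntegral hH hlog
  have hS := hY.isSelfSimilar_satoIntegral hH hlog
  ⟨hA, hS, hA.isSelfdecomposable hH hS⟩

end Direct

theorem mainTheorem2 {Ω : Type*} [MeasurableSpace Ω] (P : Measure Ω) [IsProbabilityMeasure P]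
    (H : ℝ) (hH : 0 < H) :
    (∀ Y : ℝ → Ω → ℝ, IsDoubleSidedLevy Y P →
      Integrable (fun ω ↦ Real.posLog |Y 1 ω|) P →
        (∀ᵐ ω ∂P, ∀ a : ℝ, ∃ x, HasExpIntegral (fun s ↦ Y s ω) a x) ∧
        IsSatoProcess H (satoIntegral H Y) P) ∧
    (∀ X : ℝ≥0 → Ω → ℝ, IsSatoProcess H X P →
      ∃ Y : ℝ → Ω → ℝ, IsDoubleSidedLevy Y P ∧
        Integrable (fun ω ↦ Real.posLog |Y 1 ω|) P ∧
        (∀ᵐ ω ∂P, ∀ a : ℝ, ∃ x, HasExpIntegral (fun s ↦ Y s ω) a x) ∧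
        ∀ t : ℝ≥0, X t =ᵐ[P] satoIntegral H Y t) := by
  refine ⟨fun Y hY hlog ↦ ⟨?_, hY.isSatoProcess_satoIntegral hH hlog⟩,
    fun X hX ↦ hX.exists_levy hH⟩
  filter_upwards [hY.cadlag, hY.ae_exists_exp_bound hlog] with ω hω ⟨C, hC⟩ a
  exact ⟨_, hω.hasExpIntegral hC a⟩
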